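/- \textbf{Setting.} Let $X$ and $Y_1,\dots,Y_N$ ($N\ge 1$) be real Banach spaces, let $p\ge 2$ and $1/p+1/p^*=1$. Assume that $X$ is uniformly smooth, i.e. $\rho_X(\tau)/\tau\to0$ as $\tau\searrow0$ with $\rho_X(\tau)=\sup\{\tfrac12(\|z+\tau w\|+\|z-\tau w\|)-1:\|z\|=\|w\|=1\}$, and $p$-convex, i.e. for some $K>0$ one has $\inf\{1-\tfrac12\|z+w\|:\|z\|=\|w\|=1,\ \|z-w\|\ge\tau\}\ge K\tau^p$ for all $\tau\in(0,2]$. For a Banach space $E$ and $r>1$ let $$J_r^E(x)=\{\varphi\in E^*:\langle\varphi,x\rangle=\|x\|\|\varphi\|,\ \|\varphi\|=\|x\|^{r-1}\}$$ be the duality map; on $X$ and on $X^*$ it is single-valued, and $X$ is reflexive. The Bregman distance is $$B(z,w)=\tfrac1{p^*}\|z\|^p+\tfrac1p\|w\|^p-\langle J_p^X(z),w\rangle ,$$ $B^*$ denotes the Bregman distance of $X^*$ with exponent $p^*$, and $G_{p^*}$ is the least constant with $B^*(\xi,\eta)\le\frac{G_{p^*}}{p^*}\|\eta-\xi\|^{p^*}$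 for all $\xi,\eta\in X^*$. Let $F_i:\mathcal D(F_i)\subset X\to Y_i$, $\mathcal D(F)=\bigcap_i\mathcal D(F_i)$, $F=(F_1,\dots,F_N)$, $y=(y_1,\dots,y_N)$ (exact data), and $X_{\min}=\{x\in\mathcal D(F):F(x)=y\}$. Let $S\subset\mathcal D(F)$, $x^{s}\in X_{\min}$ and $\nu>0$ be such that $\{z\in X:B(z,x^{s})\le\nu\}\subset S$. Assume that * each $F_i$ is Fréchet differentiable on $S$ (relative to $S$), with derivatives satisfying $\|F_i'(x)\|\le L_i$ for all $x\in S$; put $L_{\max}=\max_iL_i$; * there is $0<\gamma<1$ such that $\|F_i(x)-F_i(\tilde x)-F_i'(x)(x-\tilde x)\|\le\gamma\|F_i(x)-F_i(\tilde x)\|$ for all $x,\tilde x\in S$ and all $i$. Let $x_0$ satisfy $B(x_0,x^{s})\le\nu$, let $i_1,i_2,\dots$ be independent and uniformly distributed on $\{1,\dots,N\}$, let $j_i$ be any single-valued selection of $J_p^{Y_i}$, and let the SGD iterates be $$x_{k+1}=J_{p^*}^{X^*}\bigl(J_p^X(x_k)-\mu_{k+1}\,F_{i_{k+1}}'(x_k)^*\,j_{i_{k+1}}(F_{i_{k+1}}(x_k)-y_{i_{k+1}})\bigr),\qquad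 k\ge0,$$ with $X^{**}$ identified with $X$, and step sizes $\mu_k>0$ such that for some $C>0$ $$1-\gamma-L_{\max}^{p^*}\frac{G_{p^*}}{p^*}\mu_k^{p^*-1}\ge C\quad(k\ge1),\qquad \sum_{k\ge1}\mu_k=\infty .$$ \textbf{Theorem.} (1) Almost surely, $(x_k)$ converges in norm to some (random) element of $X_{\min}$; in particular, almost surely $\inf_{\tilde x\in X_{\min}}\|x_k-\tilde x\|\to0$. (2) Suppose in addition that $S$ is closed and convex and that $F$ is weak-to-weak (sequentially) continuous on $S$. Then there is exactly one $x_0$-minimum-distance solution, i.e. exactly one $x^\dagger\in S$ with $F(x^\dagger)=y$ and $B(x_0,x^\dagger)=\inf\{B(x_0,x):x\in S,\ F(x)=y\}$. If moreover $\operatorname{Null}(F'(x^\dagger))\subset\operatorname{Null}(F'(x))$ for all $x\in S$, where $\operatorname{Null}(F'(x))=\bigcap_i\operatorname{Null}(F_i'(x))$, then almost surely $x_k\to x^\dagger$ in norm and $B(x_k,x^\dagger)\to0$. (The choice $x^{s}=x^\dagger$ is allowed.) -/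

import Mathlib

open Filter Topology MeasureTheory ProbabilityTheory

noncomputable section

/-- The modulus of convexity `δ_X(τ) = inf {1 - ‖z + w‖ / 2 : ‖z‖ = ‖w‖ = 1, ‖z - w‖ ≥ τ}`, as an
extended real, so that the infimum over the empty set is `+∞`. -/
def modulusOfConvexity (X : Type*) [NormedAddCommGroup X] (τ : ℝ) : EReal :=
  ⨅ (z : X) (w : X) (_ : ‖z‖ = 1) (_ : ‖w‖ = 1) (_ : τ ≤ ‖z - w‖),
    ((1 - ‖z + w‖ / 2 : ℝ) : EReal)

/-- `X` is `p`-convex: `δ_X(τ) ≥ K τ ^ p` on `(0, 2]` for some `K > 0`. -/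
def IsPConvexSpace (X : Type*) [NormedAddCommGroup X] (p : ℝ) : Prop :=
  ∃ K : ℝ, 0 < K ∧ ∀ τ ∈ Set.Ioc (0 : ℝ) 2, ((K * τ ^ p : ℝ) : EReal) ≤ modulusOfConvexity X τ

/-- The modulus of smoothness
`ρ_X(τ) = sup {(‖z + τ w‖ + ‖z - τ w‖) / 2 - 1 : ‖z‖ = ‖w‖ = 1}`. -/
def modulusOfSmoothness (X : Type*) [NormedAddCommGroup X] [NormedSpace ℝ X] (τ : ℝ) : ℝ :=
  sSup {r : ℝ | ∃ z w : X, ‖z‖ = 1 ∧ ‖w‖ = 1 ∧ r = (‖z + τ • w‖ + ‖z - τ • w‖) / 2 - 1}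

/-- `X` is uniformly smooth: `ρ_X(τ) / τ → 0` as `τ ↘ 0`. -/
def IsUniformlySmoothSpace (X : Type*) [NormedAddCommGroup X] [NormedSpace ℝ X] : Prop :=
  Tendsto (fun τ : ℝ => modulusOfSmoothness X τ / τ) (𝓝[>] 0) (𝓝 0)

section Duality

variable {X : Type*} [NormedAddCommGroup X] [NormedSpace ℝ X]

/-- The (set-valued) duality map of `X` with gauge function `t ↦ t ^ (p - 1)`. -/
def dualityMap (p : ℝ) (x : X) : Set (StrongDual ℝ X) :=
  {φ | φ x = ‖x‖ * ‖φ‖ ∧ ‖x‖ ^ (p - 1) = ‖φ‖}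

theorem dualityMap_nonempty {p : ℝ} (hp : 1 < p) (x : X) : (dualityMap p x).Nonempty := by
  by_cases hx : x = 0
  · refine ⟨0, ?_, ?_⟩
    · simp
    · have h : p - 1 ≠ 0 := by linarith
      simp [hx, Real.zero_rpow h]
  · obtain ⟨φ, hφ, hφx⟩ := exists_dual_vector ℝ x (norm_ne_zero_iff.mpr hx)
    have hpos : (0 : ℝ) ≤ ‖x‖ ^ (p - 1) := Real.rpow_nonneg (norm_nonneg x) _
    have hn : ‖(‖x‖ ^ (p - 1)) • φ‖ = ‖x‖ ^ (p - 1) := by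
      rw [norm_smul, hφ, mul_one, Real.norm_of_nonneg hpos]
    refine ⟨(‖x‖ ^ (p - 1)) • φ, ?_, hn.symm⟩
    rw [hn, smul_apply, hφx]
    simp [mul_comm]

/-- The duality map as a single-valued map. On a smooth space `dualityMap p x` is a singleton for
every `p > 1`, and this is its only element. -/
def dmap (p : ℝ) (x : X) : StrongDual ℝ X :=
  Classical.epsilon fun φ => φ ∈ dualityMap p x

theorem dmap_mem {p : ℝ} (hp : 1 < p) (x : X) : dmap p x ∈ dualityMap p x :=
  Classical.epsilon_spec (dualityMap_nonempty hp x)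

/-- The Bregman distance
`B(z, w) = ‖z‖ ^ p / p* + ‖w‖ ^ p / p - ⟨J_p(z), w⟩`, where `1 / p + 1 / p* = 1`. -/
def bregman (p : ℝ) (z w : X) : ℝ :=
  1 / p.conjExponent * ‖z‖ ^ p + 1 / p * ‖w‖ ^ p - dmap p z w

/-- The ball of radius `ν` in the Bregman distance, `{z : B(z, x) ≤ ν}`. -/
def bregmanBall (p ν : ℝ) (x : X) : Set X := {z | bregman p z x ≤ ν}

end Duality

/-- The constant `G_{p*}` of the space `X`: the least constant such that
`B*(ξ, η) ≤ G / p* * ‖η - ξ‖ ^ p*` on the dual space, where `B*` is the Bregman distance of the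
dual space with exponent `p*`. (Such constants exist whenever `X` is `p`-convex and `p ≥ 2`.) -/
def dualBregmanConst (X : Type*) [NormedAddCommGroup X] [NormedSpace ℝ X] (p : ℝ) : ℝ :=
  sInf {G : ℝ | 0 < G ∧ ∀ ξ η : StrongDual ℝ X,
    bregman p.conjExponent ξ η ≤ G / p.conjExponent * ‖η - ξ‖ ^ p.conjExponent}

/-- Weak-to-weak (sequential) continuity on the set `S`. -/
def WeakToWeakContinuousOn {X Y : Type*} [NormedAddCommGroup X] [NormedSpace ℝ X]
    [NormedAddCommGroup Y] [NormedSpace ℝ Y] (f : X → Y) (S : Set X) : Prop :=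
  ∀ (u : ℕ → X) (x : X), (∀ n, u n ∈ S) → x ∈ S →
    Tendsto (fun n => toWeakSpace ℝ X (u n)) atTop (𝓝 (toWeakSpace ℝ X x)) →
    Tendsto (fun n => toWeakSpace ℝ Y (f (u n))) atTop (𝓝 (toWeakSpace ℝ Y (f x)))

section System

variable {N : ℕ} {X : Type*} [NormedAddCommGroup X] [NormedSpace ℝ X]
  {Y : Fin N → Type*} [∀ i, NormedAddCommGroup (Y i)] [∀ i, NormedSpace ℝ (Y i)]

/-- The set of all solutions of the system `F_i(x) = y_i`, where `F_i` has domain `D i`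
(the values of `F i` outside `D i` are irrelevant). -/
def solutionSet (D : Fin N → Set X) (F : ∀ i, X → Y i) (y : ∀ i, Y i) : Set X :=
  {x | ∀ i, x ∈ D i ∧ F i x = y i}

/-- `z` is an `x₀`-minimum-distance solution in `S`. -/
def IsMinDistanceSolution (p : ℝ) (S : Set X) (F : ∀ i, X → Y i) (y : ∀ i, Y i) (x₀ z : X) :
    Prop :=
  z ∈ S ∧ (∀ i, F i z = y i) ∧
    IsLeast (bregman p x₀ '' {x | x ∈ S ∧ ∀ i, F i x = y i}) (bregman p x₀ z)

/-- The stochastic update direction `g(x, y, i) = F_i'(x)^* j(F_i(x) - y_i)`, where `j i` is a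
selection of the duality map of `Y i`. -/
def sgdDirection (F : ∀ i, X → Y i) (F' : ∀ i, X → X →L[ℝ] Y i) (y : ∀ i, Y i)
    (j : ∀ i, Y i → StrongDual ℝ (Y i)) (x : X) (i : Fin N) : StrongDual ℝ X :=
  (j i (F i x - y i)).comp (F' i x)

/-- `x` is the SGD iteration started at `x₀` with step sizes `μ 1, μ 2, …` along the indices
`idx 1, idx 2, …`, that is `x_{k+1} = J*_{p*}(J_p(x_k) - μ_{k+1} g(x_k, y, i_{k+1}))`, where the
value of the duality map `J*_{p*}` of the dual space, an element of the bidual of `X`, is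
identified with an element of `X` through the canonical embedding. -/
def IsSGD (p : ℝ) (F : ∀ i, X → Y i) (F' : ∀ i, X → X →L[ℝ] Y i) (y : ∀ i, Y i)
    (j : ∀ i, Y i → StrongDual ℝ (Y i)) (μ : ℕ → ℝ) (idx : ℕ → Fin N) (x₀ : X) (x : ℕ → X) :
    Prop :=
  x 0 = x₀ ∧ ∀ k, NormedSpace.inclusionInDoubleDual ℝ X (x (k + 1)) =
    dmap p.conjExponent (dmap p (x k) - μ (k + 1) • sgdDirection F F' y j (x k) (idx (k + 1)))

end System

end

/-! Every step decreases the Bregman distance to a solution, on every path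
(`bregman_gradient_step_le`): the cone condition makes the sampled direction a descent direction,
smoothness of the dual controls the remainder of order `p*`, and the step-size rule leaves a gain `C
* μ * ‖r‖ ^ p`, with `r` the sampled residual. Hence the iterates stay in the Bregman ball and the
weighted sampled residuals sum to at most `ν / C`. The iterate depends only on past indices and the
next index is independent and uniform, so taking expectations makes the weighted full residuals
almost surely summable (`ae_summable_sum_of_uniform_index`). Probability enters only there.

The rest is pathwise. Summability makes the iterates Cauchy (`cauchySeq_of_summable_residualPow`),
by comparing two iterates through an intermediate one of least full residual. Divergence of the step
sizes then forces the residual of the limit to vanish.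

For the minimum-distance claims, the cone condition turns the solutions in `S` into an affine slice
of `S`, on which the uniformly convex function `bregman p x₀` has one minimiser. Under the
null-space condition all dual updates vanish on the difference of two solutions, so the difference
of the Bregman distances from the iterate to the limit and to `xdag` never changes. Minimality fixes
its sign, and both distances tend to zero. -/

section Geometry

/-! ### Convexity and smoothness of norm powers, and duality maps. -/

variable {X : Type*} [NormedAddCommGroup X] [NormedSpace ℝ X] {p q : ℝ}

theorem norm_of_mem_dualityMap {x : X} {φ : StrongDual ℝ X} (h : φ ∈ dualityMap p x) :
    ‖φ‖ = ‖x‖ ^ (p - 1) := h.2.symm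

theorem Real.mul_rpow_sub_one {t : ℝ} (ht : 0 ≤ t) (hp : 1 < p) : t * t ^ (p - 1) = t ^ p := by
  rw [mul_comm, ← Real.rpow_add_one' ht (by linarith), sub_add_cancel]

theorem apply_self_of_mem_dualityMap {x : X} {φ : StrongDual ℝ X} (h : φ ∈ dualityMap p x)
    (hp : 1 < p) : φ x = ‖x‖ ^ p := by
  rw [h.1, ← h.2, Real.mul_rpow_sub_one (norm_nonneg _) hp]

theorem norm_rpow_of_mem_dualityMap {x : X} {φ : StrongDual ℝ X} (h : φ ∈ dualityMap p x)
    (hpq : p.HolderConjugate q) : ‖φ‖ ^ q = ‖x‖ ^ p := by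
  rw [norm_of_mem_dualityMap h, ← Real.rpow_mul (norm_nonneg _), hpq.sub_one_mul_conj]

theorem StrongDual.apply_le (hpq : p.HolderConjugate q) (ξ : StrongDual ℝ X) (z : X) :
    ξ z ≤ ‖ξ‖ ^ q / q + ‖z‖ ^ p / p :=
  (Real.le_norm_self _).trans <| (ξ.le_opNorm z).trans <|
    Real.young_inequality_of_nonneg (norm_nonneg _) (norm_nonneg _) hpq.symm

theorem rpow_div_add_rpow_div (hpq : p.HolderConjugate q) (t : ℝ) : t / p + t / q = t := by
  rw [div_eq_mul_inv, div_eq_mul_inv, ← mul_add, hpq.inv_add_inv_eq_inv]; simp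

/-- Elements of the duality map are subgradients of `‖·‖ ^ p / p`. -/
theorem subgradient_of_mem_dualityMap {x : X} {φ : StrongDual ℝ X} (h : φ ∈ dualityMap p x)
    (hpq : p.HolderConjugate q) (z : X) : ‖x‖ ^ p / p + φ (z - x) ≤ ‖z‖ ^ p / p := by
  have h1 := StrongDual.apply_le hpq φ z
  rw [norm_rpow_of_mem_dualityMap h hpq] at h1
  rw [map_sub, apply_self_of_mem_dualityMap h hpq.lt]
  linarith [rpow_div_add_rpow_div hpq (‖x‖ ^ p)]

theorem bregman_eq (hp : 1 < p) (z w : X) :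
    bregman p z w = ‖w‖ ^ p / p - ‖z‖ ^ p / p - dmap p z (w - z) := by
  have hpq := Real.HolderConjugate.conjExponent hp
  rw [bregman, map_sub, apply_self_of_mem_dualityMap (dmap_mem hp z) hp]
  linear_combination rpow_div_add_rpow_div hpq (‖z‖ ^ p)

theorem bregman_self (hp : 1 < p) (z : X) : bregman p z z = 0 := by
  simp [bregman_eq hp]

theorem bregman_nonneg (hp : 1 < p) (z w : X) : 0 ≤ bregman p z w := by
  rw [bregman_eq hp]
  linarith [subgradient_of_mem_dualityMap (dmap_mem hp z)
    (Real.HolderConjugate.conjExponent hp) w]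

/-- The difference of two Bregman distances from the same point. -/
theorem bregman_sub_bregman (z v w : X) :
    bregman p z v - bregman p z w = ‖v‖ ^ p / p - ‖w‖ ^ p / p - dmap p z (v - w) := by
  rw [bregman, bregman, map_sub]; ring

/-- The three point identity. -/
theorem bregman_three_point (a b v : X) :
    bregman p a b - bregman p a v + bregman p b v - bregman p b b =
      (dmap p a - dmap p b) (v - b) := by
  simp only [bregman, map_sub, sub_apply]; ring

section Midpoint

/-- Scalar Clarkson inequality: in terms of squares, it is superadditivity of `t ^ (p / 2)` followed
by its convexity and the parallelogram law. -/
theorem rpow_add_rpow_le_half_rpow_add_rpow_sub (hp : 2 ≤ p) {a b : ℝ} (hb : 0 ≤ b)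
    (hab : b ≤ a) : a ^ p + b ^ p ≤ ((a + b) ^ p + (a - b) ^ p) / 2 := by
  have ha : 0 ≤ a := hb.trans hab
  have hr : 1 ≤ p / 2 := by linarith
  have key : ∀ t : ℝ, 0 ≤ t → t ^ p = (t ^ 2) ^ (p / 2) := fun t ht => by
    rw [← Real.rpow_natCast, ← Real.rpow_mul ht]; congr 1; push_cast; ring
  rw [key a ha, key b hb, key (a + b) (by positivity), key (a - b) (by linarith)]
  refine (Real.add_rpow_le_rpow_add (sq_nonneg a) (sq_nonneg b) hr).trans ?_
  have hc := (convexOn_rpow hr).2 (Set.mem_Ici.2 (sq_nonneg (a + b)))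
    (Set.mem_Ici.2 (sq_nonneg (a - b))) (by norm_num : (0 : ℝ) ≤ 1 / 2)
    (by norm_num : (0 : ℝ) ≤ 1 / 2) (by norm_num)
  simp only [smul_eq_mul] at hc
  have e : 1 / 2 * (a + b) ^ 2 + 1 / 2 * (a - b) ^ 2 = a ^ 2 + b ^ 2 := by ring
  rw [e] at hc
  linarith

theorem IsPConvexSpace.exists_norm_add_le (h : IsPConvexSpace X p) (hp : p ≠ 0) :
    ∃ K : ℝ, 0 < K ∧ ∀ z w : X, ‖z‖ = 1 → ‖w‖ = 1 → ‖z + w‖ / 2 ≤ 1 - K * ‖z - w‖ ^ p := by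
  obtain ⟨K, hK, hKm⟩ := h
  refine ⟨K, hK, fun z w hz hw => ?_⟩
  by_cases hzw : z = w
  · subst hzw
    rw [sub_self, norm_zero, Real.zero_rpow hp, ← two_smul ℝ z, norm_smul, hz]
    norm_num
  have hpos : 0 < ‖z - w‖ := norm_pos_iff.2 (sub_ne_zero.2 hzw)
  have hle : ‖z - w‖ ≤ 2 := (norm_sub_le _ _).trans (by rw [hz, hw]; norm_num)
  have h1 := hKm _ ⟨hpos, hle⟩
  have h2 : modulusOfConvexity X ‖z - w‖ ≤ ((1 - ‖z + w‖ / 2 : ℝ) : EReal) :=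
    iInf_le_of_le z <| iInf_le_of_le w <| iInf_le_of_le hz <| iInf_le_of_le hw <|
      iInf_le_of_le le_rfl le_rfl
  have h3 := EReal.coe_le_coe_iff.1 (h1.trans h2)
  linarith

/-- The midpoint inequality for `‖·‖ ^ p` when the first vector is normalised and dominant. -/
theorem midpoint_norm_rpow_le_aux (hp : 2 ≤ p) {K : ℝ} (hK : 0 < K)
    (hKm : ∀ z w : X, ‖z‖ = 1 → ‖w‖ = 1 → ‖z + w‖ / 2 ≤ 1 - K * ‖z - w‖ ^ p)
    {z w : X} (hz : ‖z‖ = 1) (hw : ‖w‖ ≤ 1) :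
    (‖z + w‖ / 2) ^ p + min ((1 / 8) ^ p) (K / 2 * (3 / 4) ^ p * (1 / 2) ^ (p - 1)) *
      ‖z - w‖ ^ p ≤ (1 + ‖w‖ ^ p) / 2 := by
  set s := ‖w‖ with hs
  set d := ‖z - w‖ with hd
  have hs0 : 0 ≤ s := norm_nonneg _
  have hd0 : 0 ≤ d := norm_nonneg _
  have hdp : 0 ≤ d ^ p := by positivity
  have hp0 : 0 ≤ p := by linarith
  have hclark := rpow_add_rpow_le_half_rpow_add_rpow_sub hp (a := (1 + s) / 2) (b := (1 - s) / 2)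
    (by linarith) (by linarith)
  rw [show (1 + s) / 2 + (1 - s) / 2 = 1 by ring, show (1 + s) / 2 - (1 - s) / 2 = s by ring,
    Real.one_rpow] at hclark
  have htri : ‖z + w‖ / 2 ≤ (1 + s) / 2 := by
    have := norm_add_le z w
    rw [hz] at this; linarith
  -- If the norms differ by a fixed fraction of `d`, the scalar inequality alone gives the gain `(d
  -- / 8) ^ p`. Otherwise `w` is close to its normalisation `v`, and convexity on the unit sphere
  -- applies to `z` and `v`.
  by_cases hcase : d / 4 ≤ 1 - s
  · have h1 : (‖z + w‖ / 2) ^ p ≤ ((1 + s) / 2) ^ p :=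
      Real.rpow_le_rpow (by positivity) htri hp0
    have h2 : (1 / 8) ^ p * d ^ p ≤ ((1 - s) / 2) ^ p := by
      rw [← Real.mul_rpow (by norm_num) hd0]
      exact Real.rpow_le_rpow (by positivity) (by linarith) hp0
    have h3 := mul_le_mul_of_nonneg_right
      (min_le_left ((1 / 8 : ℝ) ^ p) (K / 2 * (3 / 4) ^ p * (1 / 2) ^ (p - 1))) hdp
    linarith
  · push Not at hcase
    have hd2 : d ≤ 1 + s := by
      have := norm_sub_le z w
      rwa [hz] at this
    have hs2 : 1 / 2 ≤ s := by linarith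
    have hspos : 0 < s := by linarith
    set v := s⁻¹ • w with hv
    have hvn : ‖v‖ = 1 := by
      rw [hv, norm_smul, norm_inv, Real.norm_of_nonneg hs0, ← hs, inv_mul_cancel₀ hspos.ne']
    have hwv : w = s • v := by rw [hv, smul_inv_smul₀ hspos.ne']
    have hvw : ‖v - w‖ = 1 - s := by
      have : v - w = (1 - s) • v := by rw [hwv, sub_smul, one_smul]
      rw [this, norm_smul, hvn, mul_one, Real.norm_of_nonneg (by linarith)]
    have hzv : 3 / 4 * d ≤ ‖z - v‖ := by
      have := norm_add_le (z - v) (v - w)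
      rw [sub_add_sub_cancel, hvw, ← hd] at this
      linarith
    have h1 := hKm z v hz hvn
    have h2 : (3 / 4) ^ p * d ^ p ≤ ‖z - v‖ ^ p := by
      rw [← Real.mul_rpow (by norm_num) hd0]
      exact Real.rpow_le_rpow (by positivity) hzv hp0
    have h3 : ‖z + w‖ ≤ s * ‖z + v‖ + (1 - s) := by
      have e : z + w = s • (z + v) + (1 - s) • z := by
        rw [hwv, smul_add, sub_smul, one_smul]; abel
      calc ‖z + w‖ ≤ ‖s • (z + v)‖ + ‖(1 - s) • z‖ := by rw [e]; exact norm_add_le _ _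
        _ = s * ‖z + v‖ + (1 - s) := by
          rw [norm_smul, norm_smul, hz, Real.norm_of_nonneg hs0,
            Real.norm_of_nonneg (by linarith : 0 ≤ 1 - s), mul_one]
    set δ := K / 2 * ((3 / 4) ^ p * d ^ p) with hδ
    have hδ0 : 0 ≤ δ := by positivity
    have h4 : ‖z + w‖ / 2 ≤ (1 + s) / 2 - δ := by
      have h5 : s * (‖z + v‖ / 2) ≤ s * (1 - K * ((3 / 4) ^ p * d ^ p)) :=
        mul_le_mul_of_nonneg_left (h1.trans (by gcongr)) hs0
      have h6 : 1 / 2 * (K * ((3 / 4) ^ p * d ^ p)) ≤ s * (K * ((3 / 4) ^ p * d ^ p)) :=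
        mul_le_mul_of_nonneg_right hs2 (by positivity)
      rw [hδ]; linarith
    set n := ‖z + w‖ / 2 with hn
    set A := (1 + s) / 2 with hA
    have hn0 : 0 ≤ n := by positivity
    have hA0 : 1 / 2 ≤ A := by linarith
    have hp1 : (0 : ℝ) ≤ p - 1 := by linarith
    have h7 : n ^ p ≤ A ^ p - δ * A ^ (p - 1) := by
      rw [← Real.mul_rpow_sub_one hn0 (by linarith),
        ← Real.mul_rpow_sub_one (by linarith : 0 ≤ A) (by linarith), ← sub_mul]
      exact mul_le_mul h4 (Real.rpow_le_rpow hn0 htri hp1) (by positivity) (hn0.trans h4)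
    have h8 : δ * (1 / 2) ^ (p - 1) ≤ δ * A ^ (p - 1) :=
      mul_le_mul_of_nonneg_left (Real.rpow_le_rpow (by norm_num) hA0 hp1) hδ0
    have h9 : (0 : ℝ) ≤ ((1 - s) / 2) ^ p := Real.rpow_nonneg (by linarith) _
    have h10 := mul_le_mul_of_nonneg_right
      (min_le_right ((1 / 8 : ℝ) ^ p) (K / 2 * (3 / 4) ^ p * (1 / 2) ^ (p - 1))) hdp
    have h11 : K / 2 * (3 / 4) ^ p * (1 / 2) ^ (p - 1) * d ^ p = δ * (1 / 2) ^ (p - 1) := by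
      rw [hδ]; ring
    linarith

/-- On a `p`-convex space the function `‖·‖ ^ p` is uniformly convex of power type `p`. -/
theorem IsPConvexSpace.exists_midpoint_norm_rpow_le (h : IsPConvexSpace X p) (hp : 2 ≤ p) :
    ∃ c : ℝ, 0 < c ∧ ∀ z w : X,
      (‖z + w‖ / 2) ^ p + c * ‖z - w‖ ^ p ≤ (‖z‖ ^ p + ‖w‖ ^ p) / 2 := by
  obtain ⟨K, hK, hKm⟩ := h.exists_norm_add_le (by linarith)
  set c := min ((1 / 8 : ℝ) ^ p) (K / 2 * (3 / 4) ^ p * (1 / 2) ^ (p - 1)) with hc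
  have key : ∀ z w : X, ‖w‖ ≤ ‖z‖ →
      (‖z + w‖ / 2) ^ p + c * ‖z - w‖ ^ p ≤ (‖z‖ ^ p + ‖w‖ ^ p) / 2 := by
    intro z w hwz
    rcases eq_or_ne z 0 with rfl | hz
    · have hw : w = 0 := by simpa using hwz
      subst hw
      simp [Real.zero_rpow (by linarith : p ≠ 0)]
    have hz0 : 0 < ‖z‖ := norm_pos_iff.2 hz
    have hnorm : ∀ v : X, ‖v‖ = ‖z‖ * ‖‖z‖⁻¹ • v‖ := fun v => by
      rw [norm_smul, norm_inv, norm_norm, mul_inv_cancel_left₀ hz0.ne']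
    have h1 := midpoint_norm_rpow_le_aux hp hK hKm (z := ‖z‖⁻¹ • z) (w := ‖z‖⁻¹ • w)
      (by rw [norm_smul, norm_inv, norm_norm, inv_mul_cancel₀ hz0.ne'])
      (by rw [norm_smul, norm_inv, norm_norm, inv_mul_le_iff₀ hz0, mul_one]; exact hwz)
    rw [← smul_add, ← smul_sub, ← hc] at h1
    have h2 := mul_le_mul_of_nonneg_left h1 (Real.rpow_nonneg hz0.le p)
    rw [hnorm (z + w), hnorm (z - w), hnorm w, mul_div_assoc,
      Real.mul_rpow hz0.le (by positivity), Real.mul_rpow hz0.le (by positivity),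
      Real.mul_rpow hz0.le (by positivity)]
    linarith
  refine ⟨c, by positivity, fun z w => ?_⟩
  rcases le_total ‖w‖ ‖z‖ with h1 | h1
  · exact key z w h1
  · have := key w z h1
    rwa [add_comm w z, norm_sub_rev, add_comm (‖w‖ ^ p)] at this

end Midpoint

/-- Lower bound of the Bregman distance by the norm distance. -/
theorem le_bregman_of_midpoint (hp : 1 < p) {c : ℝ}
    (hc : ∀ z w : X, (‖z + w‖ / 2) ^ p + c * ‖z - w‖ ^ p ≤ (‖z‖ ^ p + ‖w‖ ^ p) / 2) (z w : X) :
    2 * c / p * ‖z - w‖ ^ p ≤ bregman p z w := by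
  -- The subgradient inequality is used at the midpoint of `z` and `w`; doubling it leaves the
  -- convexity gap `2 * c / p`.
  have hp0 : 0 < p := by linarith
  have h1 := subgradient_of_mem_dualityMap (dmap_mem hp z) (Real.HolderConjugate.conjExponent hp)
    ((1 / 2 : ℝ) • (z + w))
  have e : (1 / 2 : ℝ) • (z + w) - z = (1 / 2 : ℝ) • (w - z) := by module
  rw [e, norm_smul, map_smul, smul_eq_mul, Real.norm_of_nonneg (by norm_num : (0 : ℝ) ≤ 1 / 2),
    one_div_mul_eq_div, one_div_mul_eq_div] at h1
  have h2 : ((‖z + w‖ / 2) ^ p + c * ‖z - w‖ ^ p) / p ≤ ((‖z‖ ^ p + ‖w‖ ^ p) / 2) / p :=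
    div_le_div_of_nonneg_right (hc z w) hp0.le
  rw [bregman_eq hp]
  have e2 : 2 * c / p * ‖z - w‖ ^ p = 2 * (c * ‖z - w‖ ^ p / p) := by ring
  rw [add_div, div_right_comm, add_div] at h2
  rw [e2]; linarith

/-- Almost maximisers in the conjugacy formula for `‖·‖ ^ q / q`. -/
theorem StrongDual.exists_norm_rpow_le (hpq : p.HolderConjugate q) (ξ : StrongDual ℝ X) {ε : ℝ}
    (hε : 0 < ε) : ∃ z : X, ‖ξ‖ ^ q / q ≤ ξ z - ‖z‖ ^ p / p + ε := by
  -- A maximiser would be `a` times a norming unit vector. The norm need not be attained, so a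
  -- vector norming up to `ε / (a + 1)` is scaled instead.
  set a := ‖ξ‖ ^ (q - 1) with ha
  have ha0 : 0 ≤ a := by positivity
  obtain ⟨u, hu, hξu⟩ : ∃ u : X, ‖u‖ < 1 ∧ ‖ξ‖ - ε / (a + 1) < ξ u := by
    obtain ⟨u, hu, hr⟩ := ξ.exists_lt_apply_of_lt_opNorm
      (show ‖ξ‖ - ε / (a + 1) < ‖ξ‖ from sub_lt_self _ (by positivity))
    rcases le_total 0 (ξ u) with h | h
    · exact ⟨u, hu, by rwa [Real.norm_of_nonneg h] at hr⟩
    · exact ⟨-u, by rwa [norm_neg], by rwa [map_neg, ← Real.norm_of_nonpos h]⟩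
  refine ⟨a • u, ?_⟩
  have h1 : a * (‖ξ‖ - ε / (a + 1)) ≤ a * ξ u := mul_le_mul_of_nonneg_left hξu.le ha0
  have h2 : a * (ε / (a + 1)) ≤ ε := by
    rw [mul_div_assoc', div_le_iff₀ (by positivity)]; nlinarith
  have h3 : ‖a • u‖ ^ p / p ≤ ‖ξ‖ ^ q / p := by
    have : ‖a • u‖ ≤ a := by
      rw [norm_smul, Real.norm_of_nonneg ha0]
      exact mul_le_of_le_one_right ha0 hu.le
    have h4 : a ^ p = ‖ξ‖ ^ q := by
      rw [ha, ← Real.rpow_mul (norm_nonneg _), hpq.symm.sub_one_mul_conj]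
    rw [← h4]
    exact div_le_div_of_nonneg_right (Real.rpow_le_rpow (norm_nonneg _) this hpq.nonneg) hpq.nonneg
  have h5 : a * ‖ξ‖ = ‖ξ‖ ^ q := by
    rw [mul_comm, ha, Real.mul_rpow_sub_one (norm_nonneg _) hpq.symm.lt]
  rw [map_smul, smul_eq_mul]
  linarith [rpow_div_add_rpow_div hpq (‖ξ‖ ^ q)]

/-- The dual of a space whose norm power is uniformly convex of power type `p` is smooth of power
type `q`. -/
theorem StrongDual.norm_rpow_add_le (hpq : p.HolderConjugate q) {c : ℝ} (hc0 : 0 < c)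
    (hc : ∀ z w : X, (‖z + w‖ / 2) ^ p + c * ‖z - w‖ ^ p ≤ (‖z‖ ^ p + ‖w‖ ^ p) / 2)
    (ξ h : StrongDual ℝ X) :
    ‖ξ + h‖ ^ q / q + ‖ξ - h‖ ^ q / q ≤
      2 * (‖ξ‖ ^ q / q) + ((2 * c) ^ p⁻¹)⁻¹ ^ q / q * ‖h‖ ^ q := by
  refine le_of_forall_pos_le_add fun ε hε => ?_
  obtain ⟨z, hz⟩ := StrongDual.exists_norm_rpow_le hpq (ξ + h) (half_pos hε)
  obtain ⟨w, hw⟩ := StrongDual.exists_norm_rpow_le hpq (ξ - h) (half_pos hε)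
  -- Weight for Young's inequality: `l ^ p = 2 * c` makes the term in `z - w` exactly what the
  -- midpoint inequality absorbs.
  set l := (2 * c) ^ p⁻¹ with hl
  have hl0 : 0 < l := by positivity
  have hlp : l ^ p = 2 * c := by
    rw [hl, ← Real.rpow_mul (by positivity), inv_mul_cancel₀ hpq.ne_zero, Real.rpow_one]
  have h1 : h (z - w) ≤ l⁻¹ ^ q / q * ‖h‖ ^ q + 2 * c * ‖z - w‖ ^ p / p := by
    have hy := Real.young_inequality_of_nonneg (a := l⁻¹ * ‖h‖) (b := l * ‖z - w‖)
      (by positivity) (by positivity) hpq.symm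
    rw [Real.mul_rpow (by positivity) (norm_nonneg _), Real.mul_rpow hl0.le (norm_nonneg _),
      hlp] at hy
    have e : l⁻¹ * ‖h‖ * (l * ‖z - w‖) = ‖h‖ * ‖z - w‖ := by field_simp
    rw [e] at hy
    have := (Real.le_norm_self _).trans (h.le_opNorm (z - w))
    calc h (z - w) ≤ _ := this.trans hy
      _ = _ := by ring
  have h2 := StrongDual.apply_le hpq ξ ((1 / 2 : ℝ) • (z + w))
  rw [norm_smul, map_smul, smul_eq_mul, Real.norm_of_nonneg (by norm_num : (0 : ℝ) ≤ 1 / 2),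
    one_div_mul_eq_div, one_div_mul_eq_div] at h2
  have h3 : ((‖z + w‖ / 2) ^ p + c * ‖z - w‖ ^ p) / p ≤ ((‖z‖ ^ p + ‖w‖ ^ p) / 2) / p :=
    div_le_div_of_nonneg_right (hc z w) hpq.nonneg
  rw [add_div, div_right_comm, add_div] at h3
  have e2 : 2 * c * ‖z - w‖ ^ p / p = 2 * (c * ‖z - w‖ ^ p / p) := by ring
  rw [add_apply] at hz
  rw [sub_apply] at hw
  rw [map_sub] at h1
  rw [map_add] at h2
  linarith

/-- The subgradient inequality at `ξ - h` removes one side of the symmetric estimate, leaving a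
first-order expansion with remainder of order `q`. -/
theorem StrongDual.norm_rpow_add_le_of_mem_dualityMap (hpq : p.HolderConjugate q) {c : ℝ}
    (hc0 : 0 < c)
    (hc : ∀ z w : X, (‖z + w‖ / 2) ^ p + c * ‖z - w‖ ^ p ≤ (‖z‖ ^ p + ‖w‖ ^ p) / 2)
    {ξ : StrongDual ℝ X} {Φ : StrongDual ℝ (StrongDual ℝ X)} (hΦ : Φ ∈ dualityMap q ξ)
    (h : StrongDual ℝ X) :
    ‖ξ + h‖ ^ q / q ≤ ‖ξ‖ ^ q / q + Φ h + ((2 * c) ^ p⁻¹)⁻¹ ^ q / q * ‖h‖ ^ q := by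
  have h1 := StrongDual.norm_rpow_add_le hpq hc0 hc ξ h
  have h2 := subgradient_of_mem_dualityMap hΦ hpq.symm (ξ - h)
  rw [sub_sub_cancel_left, map_neg] at h2
  linarith

/-- The dual of a `p`-convex space is smooth. -/
theorem IsPConvexSpace.dualityMap_dual_subsingleton (h : IsPConvexSpace X p) (hp : 2 ≤ p)
    (hpq : p.HolderConjugate q) (ξ : StrongDual ℝ X) : (dualityMap q ξ).Subsingleton := by
  obtain ⟨c, hc0, hc⟩ := h.exists_midpoint_norm_rpow_le hp
  have key : ∀ Φ ∈ dualityMap q ξ, ∀ Ψ ∈ dualityMap q ξ, ∀ η, Ψ η ≤ Φ η := by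
    intro Φ hΦ Ψ hΨ η
    set M := ((2 * c) ^ p⁻¹)⁻¹ ^ q / q * ‖η‖ ^ q with hM
    -- One element bounds the increment along `t • η` from above, the other from below; dividing by
    -- `t` and letting `t → 0` compares them.
    have h1 : ∀ t : ℝ, 0 < t → Ψ η - Φ η ≤ M * t ^ (q - 1) := by
      intro t ht
      have h2 := StrongDual.norm_rpow_add_le_of_mem_dualityMap hpq hc0 hc hΦ (t • η)
      have h3 := subgradient_of_mem_dualityMap hΨ hpq.symm (ξ + t • η)
      rw [add_sub_cancel_left] at h3
      rw [norm_smul, Real.norm_of_nonneg ht.le, Real.mul_rpow ht.le (norm_nonneg _)] at h2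
      rw [map_smul, smul_eq_mul] at h2 h3
      rw [← Real.mul_rpow_sub_one ht.le hpq.symm.lt] at h2
      have h4 : t * (Ψ η - Φ η) ≤ t * (M * t ^ (q - 1)) := by
        rw [hM]; linarith
      exact le_of_mul_le_mul_left h4 ht
    have hq1 : 0 < q - 1 := hpq.symm.sub_one_pos
    have hlim : Tendsto (fun t : ℝ => M * t ^ (q - 1)) (𝓝[>] 0) (𝓝 (M * 0 ^ (q - 1))) :=
      ((Real.continuousAt_rpow_const 0 (q - 1) (Or.inr hq1.le)).tendsto.mono_left
        nhdsWithin_le_nhds).const_mul M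
    rw [Real.zero_rpow hq1.ne', mul_zero] at hlim
    have := ge_of_tendsto hlim (eventually_nhdsWithin_of_forall h1)
    linarith
  intro Φ hΦ Ψ hΨ
  ext η
  exact le_antisymm (key Ψ hΨ Φ hΦ η) (key Φ hΦ Ψ hΨ η)

/-- The constant `G_{p*}` satisfies the inequality that defines it. -/
theorem IsPConvexSpace.bregman_le_dualBregmanConst (h : IsPConvexSpace X p) (hp : 2 ≤ p)
    (ξ η : StrongDual ℝ X) :
    bregman p.conjExponent ξ η ≤
      dualBregmanConst X p / p.conjExponent * ‖η - ξ‖ ^ p.conjExponent := by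
  have hpq := Real.HolderConjugate.conjExponent (by linarith : 1 < p)
  set q := p.conjExponent with hq
  obtain ⟨c, hc0, hc⟩ := h.exists_midpoint_norm_rpow_le hp
  -- Without an admissible constant `sInf` would be the default value `0`; `p`-convexity supplies
  -- one.
  have hne : {G : ℝ | 0 < G ∧ ∀ ξ η : StrongDual ℝ X,
      bregman q ξ η ≤ G / q * ‖η - ξ‖ ^ q}.Nonempty := by
    refine ⟨((2 * c) ^ p⁻¹)⁻¹ ^ q, by positivity, fun ξ η => ?_⟩
    have h1 := StrongDual.norm_rpow_add_le_of_mem_dualityMap hpq hc0 hc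
      (dmap_mem hpq.symm.lt ξ) (η - ξ)
    rw [add_sub_cancel] at h1
    rw [bregman_eq hpq.symm.lt]
    linarith
  have hcl : IsClosed {G : ℝ | bregman q ξ η ≤ G / q * ‖η - ξ‖ ^ q} :=
    isClosed_le continuous_const (by fun_prop)
  exact hcl.closure_subset_iff.2 (fun G hG => hG.2 ξ η)
    (csInf_mem_closure hne ⟨0, fun G hG => hG.1.le⟩)

/-- A uniformly smooth space is smooth: its duality maps are single-valued. -/
theorem IsUniformlySmoothSpace.dualityMap_subsingleton (h : IsUniformlySmoothSpace X)
    (hp : 1 < p) (x : X) : (dualityMap p x).Subsingleton := by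
  intro φ hφ ψ hψ
  rcases eq_or_ne x 0 with rfl | hx
  · have h0 : ∀ χ ∈ dualityMap p (0 : X), χ = 0 := fun χ hχ => by
      rw [← norm_eq_zero, norm_of_mem_dualityMap hχ, norm_zero, Real.zero_rpow (by linarith)]
    rw [h0 φ hφ, h0 ψ hψ]
  have hx0 : 0 < ‖x‖ := norm_pos_iff.2 hx
  set a := ‖x‖ ^ (p - 1) with ha
  have ha0 : 0 < a := by positivity
  have hbdd : ∀ τ : ℝ, BddAbove {r : ℝ | ∃ z w : X, ‖z‖ = 1 ∧ ‖w‖ = 1 ∧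
      r = (‖z + τ • w‖ + ‖z - τ • w‖) / 2 - 1} := by
    refine fun τ => ⟨|τ|, ?_⟩
    rintro r ⟨z, w, hz, hw, rfl⟩
    have h1 := norm_add_le z (τ • w)
    have h2 := norm_sub_le z (τ • w)
    rw [norm_smul, hz, hw, Real.norm_eq_abs, mul_one] at h1 h2
    linarith
  have key : ∀ φ ∈ dualityMap p x, ∀ ψ ∈ dualityMap p x, ∀ w : X, ‖w‖ = 1 → φ w ≤ ψ w := by
    intro φ hφ ψ hψ w hw
    set z := ‖x‖⁻¹ • x with hz
    have hzn : ‖z‖ = 1 := by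
      rw [hz, norm_smul, norm_inv, norm_norm, inv_mul_cancel₀ hx0.ne']
    have hval : ∀ χ ∈ dualityMap p x, χ z = a := fun χ hχ => by
      rw [hz, map_smul, hχ.1, norm_of_mem_dualityMap hχ, smul_eq_mul,
        inv_mul_cancel_left₀ hx0.ne']
    -- Evaluate `φ` at `z + τ • w` and `ψ` at `z - τ • w`: the values sum to `2 * a + τ * (φ w - ψ
    -- w)`, which the modulus of smoothness bounds.
    have h1 : ∀ τ : ℝ, 0 < τ → φ w - ψ w ≤ 2 * a * (modulusOfSmoothness X τ / τ) := by
      intro τ hτ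
      have h2 : (‖z + τ • w‖ + ‖z - τ • w‖) / 2 - 1 ≤ modulusOfSmoothness X τ :=
        le_csSup (hbdd τ) ⟨z, w, hzn, hw, rfl⟩
      have h3 := (Real.le_norm_self _).trans (φ.le_opNorm (z + τ • w))
      have h4 := (Real.le_norm_self _).trans (ψ.le_opNorm (z - τ • w))
      rw [norm_of_mem_dualityMap hφ, map_add, hval φ hφ, map_smul, smul_eq_mul, ← ha] at h3
      rw [norm_of_mem_dualityMap hψ, map_sub, hval ψ hψ, map_smul, smul_eq_mul, ← ha] at h4
      rw [mul_div_assoc', le_div_iff₀ hτ]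
      have h5 := mul_le_mul_of_nonneg_left h2 ha0.le
      linarith
    have hlim := h.const_mul (2 * a)
    rw [mul_zero] at hlim
    have := ge_of_tendsto hlim (eventually_nhdsWithin_of_forall h1)
    linarith
  ext v
  rcases eq_or_ne v 0 with rfl | hv
  · simp
  have hv0 : 0 < ‖v‖ := norm_pos_iff.2 hv
  have hvn : ‖‖v‖⁻¹ • v‖ = 1 := by rw [norm_smul, norm_inv, norm_norm, inv_mul_cancel₀ hv0.ne']
  have h1 := le_antisymm (key φ hφ ψ hψ _ hvn) (key ψ hψ φ hφ _ hvn)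
  rw [map_smul, map_smul] at h1
  exact smul_right_injective ℝ (inv_ne_zero hv0.ne') h1

theorem IsUniformlySmoothSpace.eq_dmap (h : IsUniformlySmoothSpace X) (hp : 1 < p) {x : X}
    {φ : StrongDual ℝ X} (hφ : φ ∈ dualityMap p x) : φ = dmap p x :=
  h.dualityMap_subsingleton hp x hφ (dmap_mem hp x)

theorem norm_inclusionInDoubleDual (x : X) :
    ‖NormedSpace.inclusionInDoubleDual ℝ X x‖ = ‖x‖ :=
  (NormedSpace.inclusionInDoubleDualLi ℝ).norm_map x

/-- The duality maps with exponents `p` and `q` are inverse to each other because `(p - 1) * (q - 1)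
= 1`. Restricting to bidual elements that come from `X` avoids any appeal to reflexivity. -/
theorem inclusionInDoubleDual_mem_dualityMap_iff (hpq : p.HolderConjugate q) {x : X}
    {φ : StrongDual ℝ X} :
    NormedSpace.inclusionInDoubleDual ℝ X x ∈ dualityMap q φ ↔ φ ∈ dualityMap p x := by
  have e : (p - 1) * (q - 1) = 1 := by linear_combination hpq.mul_eq_add
  simp only [dualityMap, Set.mem_ofPred_eq, norm_inclusionInDoubleDual,
    NormedSpace.dual_def, mul_comm ‖φ‖]
  refine and_congr_right fun _ => ⟨fun h => ?_, fun h => ?_⟩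
  · rw [← h, ← Real.rpow_mul (norm_nonneg _), mul_comm, e, Real.rpow_one]
  · rw [← h, ← Real.rpow_mul (norm_nonneg _), e, Real.rpow_one]

/-- Norm-to-weak* continuity of single-valued duality maps. -/
theorem IsUniformlySmoothSpace.tendsto_dmap_apply (h : IsUniformlySmoothSpace X) (hp : 1 < p)
    {u : ℕ → X} {x : X} (hu : Tendsto u atTop (𝓝 x)) (v : X) :
    Tendsto (fun k => dmap p (u k) v) atTop (𝓝 (dmap p x v)) := by
  have hnorm : Tendsto (fun k => ‖dmap p (u k)‖) atTop (𝓝 (‖x‖ ^ (p - 1))) := by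
    have := hu.norm.rpow_const (p := p - 1) (Or.inr (by linarith))
    exact this.congr fun k => (dmap_mem hp (u k)).2
  obtain ⟨R, hR⟩ := hnorm.bddAbove_range
  have hR' : ∀ k, ‖dmap p (u k)‖ ≤ R := fun k => hR ⟨k, rfl⟩
  -- Banach–Alaoglu gives a weak* limit along each ultrafilter; it lies in `dualityMap p x`, which
  -- is a singleton.
  refine (tendsto_iff_ultrafilter _ _ _).2 fun U hU => ?_
  have hcomp := WeakDual.isCompact_closedBall (𝕜 := ℝ) (0 : StrongDual ℝ X) R
  obtain ⟨φ, -, hφ⟩ := hcomp.ultrafilter_le_nhds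
    (U.map fun k => StrongDual.toWeakDual (dmap p (u k))) (by
      rw [le_principal_iff]
      refine Filter.mem_map.2 (Filter.univ_mem' fun k => ?_)
      simpa using hR' k)
  have hφv : ∀ v, Tendsto (fun k => dmap p (u k) v) U (𝓝 (φ v)) := fun v =>
    ((WeakDual.eval_continuous v).tendsto φ).comp hφ
  set ψ : StrongDual ℝ X := WeakDual.toStrongDual φ with hψ
  have huU : Tendsto u U (𝓝 x) := hu.mono_left hU
  have hnU : Tendsto (fun k => ‖dmap p (u k)‖) U (𝓝 (‖x‖ ^ (p - 1))) := hnorm.mono_left hU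
  have h1 : ‖ψ‖ ≤ ‖x‖ ^ (p - 1) := by
    refine ψ.opNorm_le_bound (by positivity) fun v => ?_
    exact le_of_tendsto_of_tendsto (hφv v).norm (hnU.mul_const ‖v‖)
      (Eventually.of_forall fun k => (dmap p (u k)).le_opNorm v)
  have h2 : ψ x = ‖x‖ ^ p := by
    have ha : Tendsto (fun k => dmap p (u k) (u k)) U (𝓝 (‖x‖ ^ p)) :=
      (huU.norm.rpow_const (p := p) (Or.inr (by linarith))).congr fun k =>
        (apply_self_of_mem_dualityMap (dmap_mem hp (u k)) hp).symm
    have hb : Tendsto (fun k => dmap p (u k) (x - u k)) U (𝓝 0) := by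
      have h0 : Tendsto (fun k => R * ‖x - u k‖) U (𝓝 0) := by
        have := ((tendsto_const_nhds (x := x)).sub huU).norm.const_mul R
        simpa using this
      refine squeeze_zero_norm (fun k => ?_) h0
      exact ((dmap p (u k)).le_opNorm _).trans (by gcongr; exact hR' k)
    refine tendsto_nhds_unique (hφv x) ?_
    simpa using ha.add hb
  have hmem : ψ ∈ dualityMap p x := by
    have h3 : ‖x‖ ^ (p - 1) = ‖ψ‖ := by
      refine le_antisymm ?_ h1
      rcases eq_or_ne x 0 with rfl | hx
      · rw [norm_zero, Real.zero_rpow (by linarith)]; positivity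
      have hx0 : 0 < ‖x‖ := norm_pos_iff.2 hx
      have h4 := (Real.le_norm_self _).trans (ψ.le_opNorm x)
      rw [h2, ← Real.mul_rpow_sub_one hx0.le hp, mul_comm] at h4
      exact le_of_mul_le_mul_right h4 hx0
    exact ⟨by rw [h2, ← h3, Real.mul_rpow_sub_one (norm_nonneg _) hp], h3⟩
  rw [← h.eq_dmap hp hmem]
  exact hφv v

theorem IsUniformlySmoothSpace.tendsto_bregman_left (h : IsUniformlySmoothSpace X) (hp : 1 < p)
    {u : ℕ → X} {x : X} (hu : Tendsto u atTop (𝓝 x)) (w : X) :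
    Tendsto (fun k => bregman p (u k) w) atTop (𝓝 (bregman p x w)) := by
  have h1 := hu.norm.rpow_const (p := p) (Or.inr (by linarith))
  exact ((h1.const_mul _).add_const _).sub (h.tendsto_dmap_apply hp hu w)

end Geometry

/-! ### Descent of the Bregman distance in one step. -/

section Step

variable {X : Type*} [NormedAddCommGroup X] [NormedSpace ℝ X] {p : ℝ}

theorem dualBregmanConst_nonneg : 0 ≤ dualBregmanConst X p :=
  Real.sInf_nonneg fun _ hG => hG.1.le

/-- Inverts the outer duality map of the iteration, so that the update becomes additive in the dual
variable. -/
theorem IsUniformlySmoothSpace.dmap_eq_of_inclusion_eq (h : IsUniformlySmoothSpace X) (hp : 1 < p)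
    {x : X} {η : StrongDual ℝ X}
    (hx : NormedSpace.inclusionInDoubleDual ℝ X x = dmap p.conjExponent η) : dmap p x = η := by
  have hpq := Real.HolderConjugate.conjExponent hp
  have h1 := dmap_mem hpq.symm.lt η
  rw [← hx, inclusionInDoubleDual_mem_dualityMap_iff hpq] at h1
  exact (h.eq_dmap hp h1).symm

/-- Change of the Bregman distance under a dual step. -/
theorem bregman_dual_step_le (hp : 2 ≤ p) (hconv : IsPConvexSpace X p) {x x' : X}
    {g : StrongDual ℝ X} (hx' : dmap p x' = dmap p x - g) (z : X) :
    bregman p x' z ≤ bregman p x z - g (x - z) +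
      dualBregmanConst X p / p.conjExponent * ‖g‖ ^ p.conjExponent := by
  have hp1 : 1 < p := by linarith
  have hpq := Real.HolderConjugate.conjExponent hp1
  set q := p.conjExponent with hq
  have h1 := hconv.bregman_le_dualBregmanConst hp (dmap p x) (dmap p x')
  have h2 : dmap q (dmap p x) = NormedSpace.inclusionInDoubleDual ℝ X x :=
    hconv.dualityMap_dual_subsingleton hp hpq _ (dmap_mem hpq.symm.lt _)
      ((inclusionInDoubleDual_mem_dualityMap_iff hpq).2 (dmap_mem hp1 x))
  have h3 : dmap p x' - dmap p x = -g := by rw [hx']; abel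
  rw [← hq, bregman_eq hpq.symm.lt, h2, NormedSpace.dual_def, h3,
    norm_rpow_of_mem_dualityMap (dmap_mem hp1 x') hpq,
    norm_rpow_of_mem_dualityMap (dmap_mem hp1 x) hpq, norm_neg, neg_apply] at h1
  have h4 : dmap p x' z = dmap p x z - g z := by rw [hx', sub_apply]
  rw [bregman, bregman, h4, map_sub, ← hq, one_div_mul_eq_div, one_div_mul_eq_div,
    one_div_mul_eq_div]
  linarith

/-- Descent of the Bregman distance in one gradient step with exact data. -/
theorem bregman_gradient_step_le {Y : Type*} [NormedAddCommGroup Y] [NormedSpace ℝ Y]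
    (hp : 2 ≤ p) (hconv : IsPConvexSpace X p) {x x' z : X} {A : X →L[ℝ] Y} {r : Y}
    {φ : StrongDual ℝ Y} (hφ : φ ∈ dualityMap p r) {L γ C μ : ℝ} (hA : ‖A‖ ≤ L)
    (hr : ‖r - A (x - z)‖ ≤ γ * ‖r‖) (hμ : 0 < μ)
    (hC : C ≤ 1 - γ - L ^ p.conjExponent * (dualBregmanConst X p / p.conjExponent) *
      μ ^ (p.conjExponent - 1))
    (hx' : dmap p x' = dmap p x - μ • φ.comp A) :
    bregman p x' z + C * (μ * ‖r‖ ^ p) ≤ bregman p x z := by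
  have hp1 : 1 < p := by linarith
  have hpq := Real.HolderConjugate.conjExponent hp1
  have h1 := bregman_dual_step_le hp hconv hx' z
  set q := p.conjExponent with hq
  have hL : 0 ≤ L := (norm_nonneg _).trans hA
  have hG : 0 ≤ dualBregmanConst X p / q := div_nonneg dualBregmanConst_nonneg hpq.symm.nonneg
  have hrp : 0 ≤ ‖r‖ ^ p := by positivity
  have h2 : ‖μ • φ.comp A‖ ^ q ≤ μ * μ ^ (q - 1) * (‖r‖ ^ p * L ^ q) := by
    have h3 : ‖μ • φ.comp A‖ ≤ μ * (‖φ‖ * L) := by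
      rw [norm_smul, Real.norm_of_nonneg hμ.le]
      exact mul_le_mul_of_nonneg_left ((φ.opNorm_comp_le A).trans (by gcongr)) hμ.le
    refine (Real.rpow_le_rpow (norm_nonneg _) h3 hpq.symm.nonneg).trans_eq ?_
    rw [Real.mul_rpow hμ.le (by positivity), Real.mul_rpow (norm_nonneg _) hL,
      norm_rpow_of_mem_dualityMap hφ hpq, Real.mul_rpow_sub_one hμ.le hpq.symm.lt]
  -- Write `A (x - z)` as `r` minus the linearisation error: `φ r = ‖r‖ ^ p`, and the error costs at
  -- most the fraction `γ` of it.
  have h4 : (1 - γ) * ‖r‖ ^ p ≤ φ (A (x - z)) := by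
    have h5 := (Real.le_norm_self _).trans (φ.le_opNorm (r - A (x - z)))
    have h6 : ‖φ‖ * ‖r - A (x - z)‖ ≤ ‖φ‖ * (γ * ‖r‖) :=
      mul_le_mul_of_nonneg_left hr (norm_nonneg _)
    have h7 : ‖φ‖ * ‖r‖ = ‖r‖ ^ p := by
      rw [norm_of_mem_dualityMap hφ, mul_comm, Real.mul_rpow_sub_one (norm_nonneg _) hp1]
    rw [map_sub, apply_self_of_mem_dualityMap hφ hp1] at h5
    have h8 : ‖φ‖ * (γ * ‖r‖) = γ * ‖r‖ ^ p := by rw [← h7]; ring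
    linarith
  have h9 := mul_le_mul_of_nonneg_left h2 hG
  have h10 := mul_le_mul_of_nonneg_left h4 hμ.le
  have h11 := mul_le_mul_of_nonneg_left hC (mul_nonneg hμ.le hrp)
  have h12 : (μ • φ.comp A) (x - z) = μ * φ (A (x - z)) := rfl
  rw [h12] at h1
  linarith

end Step

/-! ### The full residual. -/

section Residual

variable {N : ℕ} {X : Type*} {Y : Fin N → Type*} [∀ i, NormedAddCommGroup (Y i)] {p : ℝ}
  {F : ∀ i, X → Y i} {y : ∀ i, Y i}

/-- The sum of the `p`-th powers of the residualPow norms. -/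
noncomputable def residualPow (p : ℝ) (F : ∀ i, X → Y i) (y : ∀ i, Y i) (x : X) : ℝ :=
  ∑ i, ‖F i x - y i‖ ^ p

theorem residualPow_nonneg (x : X) : 0 ≤ residualPow p F y x :=
  Finset.sum_nonneg fun _ _ => by positivity

theorem norm_le_residualPow_rpow (hp : 0 < p) (x : X) (i : Fin N) :
    ‖F i x - y i‖ ≤ residualPow p F y x ^ p⁻¹ := by
  have h1 : ‖F i x - y i‖ ^ p ≤ residualPow p F y x :=
    Finset.single_le_sum (f := fun i => ‖F i x - y i‖ ^ p) (fun _ _ => by positivity)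
      (Finset.mem_univ i)
  have h2 := Real.rpow_le_rpow (by positivity) h1 (inv_nonneg.2 hp.le)
  rwa [← Real.rpow_mul (norm_nonneg _), mul_inv_cancel₀ hp.ne', Real.rpow_one] at h2

end Residual

/-! ### Convergence along a single path. -/

section Path

variable {N : ℕ} {X : Type*} [NormedAddCommGroup X] [NormedSpace ℝ X]
  {Y : Fin N → Type*} [∀ i, NormedAddCommGroup (Y i)] [∀ i, NormedSpace ℝ (Y i)]
  {p : ℝ} {F : ∀ i, X → Y i} {F' : ∀ i, X → X →L[ℝ] Y i} {y : ∀ i, Y i} {S : Set X} {γ : ℝ}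
  {j : ∀ i, Y i → StrongDual ℝ (Y i)} {μ : ℕ → ℝ} {s : ℕ → Fin N} {u : ℕ → X}

theorem norm_derivative_sub_le
    (hTCC : ∀ i, ∀ x ∈ S, ∀ x' ∈ S, ‖F i x - F i x' - F' i x (x - x')‖ ≤ γ * ‖F i x - F i x'‖)
    (i : Fin N) {x x' : X} (hx : x ∈ S) (hx' : x' ∈ S) :
    ‖F' i x (x - x')‖ ≤ (1 + γ) * ‖F i x - F i x'‖ := by
  have h1 := hTCC i x hx x' hx'
  have h2 := norm_sub_le (F i x - F i x') (F i x - F i x' - F' i x (x - x'))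
  rw [sub_sub_cancel] at h2
  linarith

/-- The tangential cone condition turns the solutions in `S` into the intersection of `S` with an
affine subspace. -/
theorem forall_eq_iff_sub_mem_iInf_ker (hγ₁ : γ < 1)
    (hTCC : ∀ i, ∀ x ∈ S, ∀ x' ∈ S, ‖F i x - F i x' - F' i x (x - x')‖ ≤ γ * ‖F i x - F i x'‖)
    {z w : X} (hz : z ∈ S) (hFz : ∀ i, F i z = y i) (hw : w ∈ S) :
    (∀ i, F i w = y i) ↔ w - z ∈ ⨅ i, (F' i z).ker := by
  simp only [Submodule.mem_iInf]
  refine forall_congr' fun i => ⟨fun h => ?_, fun h => ?_⟩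
  · have h1 := norm_derivative_sub_le hTCC i hz hw
    rw [h, hFz, sub_self, norm_zero, mul_zero] at h1
    have h2 : F' i z (z - w) = 0 := norm_le_zero_iff.1 h1
    change F' i z (w - z) = 0
    rw [← neg_sub, map_neg, h2, neg_zero]
  · have h1 := hTCC i z hz w hw
    have h2 : F' i z (z - w) = 0 := by
      rw [← neg_sub, map_neg]
      exact neg_eq_zero.2 h
    rw [h2, sub_zero, hFz] at h1
    have h3 : ‖y i - F i w‖ ≤ 0 := by nlinarith [norm_nonneg (y i - F i w)]
    exact (sub_eq_zero.1 (norm_le_zero_iff.1 h3)).symm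

/-- Split `z - w` as `(x - w) - (x - z)` and apply the cone condition at `x`: the two pieces
contribute `2 * T` and `T`, whence the factor `3`. The full residual is needed because `w` has the
smaller total, which says nothing about the single sampled component. -/
theorem abs_sgdDirection_apply_le (hp : 1 < p) (hγ₀ : 0 < γ)
    (hTCC : ∀ i, ∀ x ∈ S, ∀ x' ∈ S, ‖F i x - F i x' - F' i x (x - x')‖ ≤ γ * ‖F i x - F i x'‖)
    (hj : ∀ i v, j i v ∈ dualityMap p v)
    {x z w : X} (hx : x ∈ S) (hz : z ∈ S) (hw : w ∈ S) (hFz : ∀ i, F i z = y i)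
    (hwx : residualPow p F y w ≤ residualPow p F y x) (i : Fin N) :
    |sgdDirection F F' y j x i (z - w)| ≤ 3 * (1 + γ) * residualPow p F y x := by
  set T := residualPow p F y x ^ p⁻¹ with hT
  have hR := residualPow_nonneg (p := p) (F := F) (y := y) x
  have hRw := residualPow_nonneg (p := p) (F := F) (y := y) w
  have hp0 : 0 < p := by linarith
  have hT0 : 0 ≤ T := by positivity
  have hTp : T ^ p = residualPow p F y x := by
    rw [hT, ← Real.rpow_mul hR, inv_mul_cancel₀ hp0.ne', Real.rpow_one]
  have h1 : ‖F i x - y i‖ ≤ T := norm_le_residualPow_rpow hp0 x i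
  have h2 : ‖F i w - y i‖ ≤ T := (norm_le_residualPow_rpow hp0 w i).trans
    (Real.rpow_le_rpow hRw hwx (inv_nonneg.2 hp0.le))
  have h3 := norm_derivative_sub_le hTCC i hx hz
  have h4 := norm_derivative_sub_le hTCC i hx hw
  rw [hFz] at h3
  have h5 : ‖F i x - F i w‖ ≤ 2 * T := by
    have := norm_sub_le (F i x - y i) (F i w - y i)
    rw [sub_sub_sub_cancel_right] at this
    linarith
  have h6 : ‖F' i x (z - w)‖ ≤ 3 * (1 + γ) * T := by
    have e : F' i x (z - w) = F' i x (x - w) - F' i x (x - z) := by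
      rw [← map_sub, sub_sub_sub_cancel_left]
    rw [e]
    refine (norm_sub_le _ _).trans ?_
    have h7 := mul_le_mul_of_nonneg_left h1 (by linarith : 0 ≤ 1 + γ)
    have h8 := mul_le_mul_of_nonneg_left h5 (by linarith : 0 ≤ 1 + γ)
    linarith
  have h9 : ‖j i (F i x - y i)‖ ≤ T ^ (p - 1) := by
    rw [norm_of_mem_dualityMap (hj i _)]
    exact Real.rpow_le_rpow (norm_nonneg _) h1 (by linarith)
  calc |sgdDirection F F' y j x i (z - w)| = ‖j i (F i x - y i) (F' i x (z - w))‖ := rfl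
    _ ≤ ‖j i (F i x - y i)‖ * ‖F' i x (z - w)‖ := ContinuousLinearMap.le_opNorm _ _
    _ ≤ T ^ (p - 1) * (3 * (1 + γ) * T) := by gcongr
    _ = 3 * (1 + γ) * (T * T ^ (p - 1)) := by ring
    _ = 3 * (1 + γ) * residualPow p F y x := by rw [Real.mul_rpow_sub_one hT0 hp, hTp]

theorem dmap_sub_dmap_eq_sum
    (hu : ∀ k, dmap p (u (k + 1)) = dmap p (u k) - μ (k + 1) • sgdDirection F F' y j (u k) (s k))
    {a b : ℕ} (hab : a ≤ b) :
    dmap p (u a) - dmap p (u b) =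
      ∑ m ∈ Finset.Ico a b, μ (m + 1) • sgdDirection F F' y j (u m) (s m) := by
  induction b, hab using Nat.le_induction with
  | base => simp
  | succ b hab ih => rw [Finset.sum_Ico_succ_top hab, ← ih, hu b]; abel

theorem abs_dmap_sub_dmap_apply_le (hp : 1 < p) (hγ₀ : 0 < γ)
    (hTCC : ∀ i, ∀ x ∈ S, ∀ x' ∈ S, ‖F i x - F i x' - F' i x (x - x')‖ ≤ γ * ‖F i x - F i x'‖)
    (hj : ∀ i v, j i v ∈ dualityMap p v) (hμ : ∀ k, 0 < μ (k + 1))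
    (hu : ∀ k, dmap p (u (k + 1)) = dmap p (u k) - μ (k + 1) • sgdDirection F F' y j (u k) (s k))
    (huS : ∀ k, u k ∈ S) {z w : X} (hz : z ∈ S) (hFz : ∀ i, F i z = y i) (hw : w ∈ S)
    {a b : ℕ} (hab : a ≤ b)
    (hwu : ∀ m, a ≤ m → m < b → residualPow p F y w ≤ residualPow p F y (u m)) :
    |(dmap p (u a) - dmap p (u b)) (z - w)| ≤
      3 * (1 + γ) * ∑ m ∈ Finset.Ico a b, μ (m + 1) * residualPow p F y (u m) := by
  rw [dmap_sub_dmap_eq_sum hu hab, sum_apply, Finset.mul_sum]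
  refine (Finset.abs_sum_le_sum_abs _ _).trans (Finset.sum_le_sum fun m hm => ?_)
  obtain ⟨h1, h2⟩ := Finset.mem_Ico.1 hm
  have h3 := abs_sgdDirection_apply_le hp hγ₀ hTCC hj (huS m) hz hw hFz (hwu m h1 h2) (s m)
  rw [smul_apply, smul_eq_mul, abs_mul, abs_of_pos (hμ m)]
  calc _ ≤ μ (m + 1) * (3 * (1 + γ) * residualPow p F y (u m)) :=
        mul_le_mul_of_nonneg_left h3 (hμ m).le
    _ = _ := by ring

/-- Along a path with summable weighted residuals the iterates form a Cauchy sequence. -/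
theorem cauchySeq_of_summable_residualPow (hp : 2 ≤ p) (hconv : IsPConvexSpace X p) (hγ₀ : 0 < γ)
    (hTCC : ∀ i, ∀ x ∈ S, ∀ x' ∈ S, ‖F i x - F i x' - F' i x (x - x')‖ ≤ γ * ‖F i x - F i x'‖)
    (hj : ∀ i v, j i v ∈ dualityMap p v) (hμ : ∀ k, 0 < μ (k + 1))
    (hu : ∀ k, dmap p (u (k + 1)) = dmap p (u k) - μ (k + 1) • sgdDirection F F' y j (u k) (s k))
    (huS : ∀ k, u k ∈ S) {z : X} (hz : z ∈ S) (hFz : ∀ i, F i z = y i)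
    (hanti : Antitone fun k => bregman p (u k) z)
    (hsum : Summable fun k => μ (k + 1) * residualPow p F y (u k)) : CauchySeq u := by
  have hp1 : 1 < p := by linarith
  obtain ⟨c, hc0, hc⟩ := hconv.exists_midpoint_norm_rpow_le hp
  have hb : CauchySeq fun k => bregman p (u k) z :=
    (tendsto_atTop_ciInf hanti ⟨0, by rintro _ ⟨k, rfl⟩; exact bregman_nonneg hp1 _ _⟩).cauchySeq
  have hW := hsum.hasSum.tendsto_sum_nat.cauchySeq
  rw [Metric.cauchySeq_iff'] at hb hW ⊢
  intro ε hε
  set c' := 2 * c / p with hc'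
  have hc'0 : 0 < c' := by positivity
  set M := 3 * (1 + γ) with hM
  have hM0 : 0 < M := by positivity
  set δ := c' * (ε / 2) ^ p with hδ
  have hδ0 : 0 < δ := by positivity
  obtain ⟨n₁, hn₁⟩ := hb (δ / 4) (by positivity)
  obtain ⟨n₂, hn₂⟩ := hW (δ / (8 * M)) (by positivity)
  set a := max n₁ n₂ with ha
  have htail : ∀ k l, a ≤ k → k ≤ l →
      M * ∑ m ∈ Finset.Ico k l, μ (m + 1) * residualPow p F y (u m) ≤ δ / 4 := by
    intro k l hk hkl
    have h1 := hn₂ k ((le_max_right _ _).trans hk)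
    have h2 := hn₂ l (((le_max_right _ _).trans hk).trans hkl)
    rw [Real.dist_eq, abs_lt] at h1 h2
    rw [Finset.sum_Ico_eq_sub _ hkl]
    have h3 : M * (δ / (8 * M)) = δ / 8 := by field_simp
    have h4 : (∑ m ∈ Finset.range l, μ (m + 1) * residualPow p F y (u m)) -
        ∑ m ∈ Finset.range k, μ (m + 1) * residualPow p F y (u m) ≤ 2 * (δ / (8 * M)) := by
      linarith
    have := mul_le_mul_of_nonneg_left h4 hM0.le
    linarith
  refine ⟨a, fun b hab => ?_⟩
  -- The pivot `l` has least full residual on `[a, b]`, so both dual increments, from `a` to `l` and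
  -- from `l` to `b`, are controlled by tails of the summable series.
  obtain ⟨l, hl, hlmin⟩ := Finset.exists_min_image (Finset.Icc a b)
    (fun m => residualPow p F y (u m)) ⟨a, Finset.left_mem_Icc.2 hab⟩
  obtain ⟨hal, hlb⟩ := Finset.mem_Icc.1 hl
  have hnorm : ∀ k, bregman p (u k) (u l) < δ → ‖u k - u l‖ < ε / 2 := by
    intro k h
    by_contra! hcon
    have h1 := le_bregman_of_midpoint hp1 hc (u k) (u l)
    have h2 : δ ≤ c' * ‖u k - u l‖ ^ p :=
      mul_le_mul_of_nonneg_left (Real.rpow_le_rpow (by positivity) hcon (by linarith)) hc'0.le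
    linarith
  have hmin : ∀ m, a ≤ m → m ≤ b → residualPow p F y (u l) ≤ residualPow p F y (u m) :=
    fun m h1 h2 => hlmin m (Finset.mem_Icc.2 ⟨h1, h2⟩)
  have hBa : bregman p (u a) (u l) < δ := by
    have h1 := bregman_three_point (p := p) (u a) (u l) z
    rw [bregman_self hp1] at h1
    have h2 := (le_abs_self _).trans (abs_dmap_sub_dmap_apply_le hp1 hγ₀ hTCC hj hμ hu huS hz hFz
      (huS l) hal fun m h1 h2 => hmin m h1 (h2.le.trans hlb))
    have h3 := htail a l le_rfl hal
    have h4 := hn₁ a (le_max_left _ _)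
    have h5 := hn₁ l ((le_max_left _ _).trans hal)
    rw [Real.dist_eq, abs_lt] at h4 h5
    linarith
  have hBb : bregman p (u b) (u l) < δ := by
    have h1 := bregman_three_point (p := p) (u b) (u l) z
    rw [bregman_self hp1] at h1
    have h2 := (neg_le_abs _).trans (abs_dmap_sub_dmap_apply_le hp1 hγ₀ hTCC hj hμ hu huS hz hFz
      (huS l) hlb fun m h1 h2 => hmin m (hal.trans h1) h2.le)
    rw [← neg_apply, neg_sub] at h2
    have h3 := htail l b hal hlb
    have h4 : bregman p (u b) z ≤ bregman p (u l) z := hanti hlb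
    linarith
  have h1 := hnorm a hBa
  have h2 := hnorm b hBb
  rw [dist_eq_norm, ← sub_sub_sub_cancel_right _ _ (u l)]
  exact (norm_sub_le _ _).trans_lt (by linarith)

/-- Along a path with summable weighted residuals the iterates converge to a solution. -/
theorem exists_tendsto_of_summable_residualPow [CompleteSpace X] (hp : 2 ≤ p)
    (hconv : IsPConvexSpace X p) (hsmooth : IsUniformlySmoothSpace X) (hγ₀ : 0 < γ)
    (hTCC : ∀ i, ∀ x ∈ S, ∀ x' ∈ S, ‖F i x - F i x' - F' i x (x - x')‖ ≤ γ * ‖F i x - F i x'‖)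
    (hF : ∀ i, ContinuousOn (F i) S)
    (hj : ∀ i v, j i v ∈ dualityMap p v) (hμ : ∀ k, 0 < μ (k + 1))
    (hμsum : Tendsto (fun n => ∑ k ∈ Finset.range n, μ (k + 1)) atTop atTop)
    (hu : ∀ k, dmap p (u (k + 1)) = dmap p (u k) - μ (k + 1) • sgdDirection F F' y j (u k) (s k))
    {z : X} {ν : ℝ} (hν : 0 ≤ ν) (hball : bregmanBall p ν z ⊆ S)
    (huν : ∀ k, u k ∈ bregmanBall p ν z) (hFz : ∀ i, F i z = y i)
    (hanti : Antitone fun k => bregman p (u k) z)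
    (hsum : Summable fun k => μ (k + 1) * residualPow p F y (u k)) :
    ∃ xhat ∈ S, (∀ i, F i xhat = y i) ∧ Tendsto u atTop (𝓝 xhat) := by
  have hp1 : 1 < p := by linarith
  have huS : ∀ k, u k ∈ S := fun k => hball (huν k)
  have hz : z ∈ S := hball (by simpa [bregmanBall, bregman_self hp1] using hν)
  obtain ⟨xhat, hxhat⟩ := cauchySeq_tendsto_of_complete
    (cauchySeq_of_summable_residualPow hp hconv hγ₀ hTCC hj hμ hu huS hz hFz hanti hsum)
  have hxS : xhat ∈ S := hball <|
    le_of_tendsto (hsmooth.tendsto_bregman_left hp1 hxhat z) (Eventually.of_forall huν)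
  refine ⟨xhat, hxS, ?_, hxhat⟩
  have hFlim : ∀ i, Tendsto (fun k => F i (u k)) atTop (𝓝 (F i xhat)) := fun i =>
    (hF i xhat hxS).tendsto.comp
      (tendsto_nhdsWithin_iff.2 ⟨hxhat, Eventually.of_forall huS⟩)
  have hRlim : Tendsto (fun k => residualPow p F y (u k)) atTop (𝓝 (residualPow p F y xhat)) :=
    tendsto_finsetSum _ fun i _ =>
      ((hFlim i).sub_const (y i)).norm.rpow_const (Or.inr (by linarith))
  -- A positive limit residual would bound the step sizes by a multiple of a summable series.
  have hR0 : residualPow p F y xhat = 0 := by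
    by_contra hne
    have hpos : 0 < residualPow p F y xhat := lt_of_le_of_ne (residualPow_nonneg _) (Ne.symm hne)
    have hev : ∀ᶠ k in atTop, residualPow p F y xhat / 2 < residualPow p F y (u k) :=
      hRlim.eventually_const_lt (half_lt_self hpos)
    have hsμ : Summable fun k => μ (k + 1) := by
      refine Summable.of_norm_bounded_eventually_nat
        (hsum.mul_left (2 / residualPow p F y xhat)) ?_
      filter_upwards [hev] with k hk
      rw [Real.norm_of_nonneg (hμ k).le, div_mul_eq_mul_div, le_div_iff₀ hpos]
      nlinarith [hμ k]
    exact not_tendsto_nhds_of_tendsto_atTop hμsum _ hsμ.hasSum.tendsto_sum_nat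
  intro i
  have h1 := norm_le_residualPow_rpow (p := p) (F := F) (y := y) (by linarith) xhat i
  rw [hR0, Real.zero_rpow (inv_ne_zero (by linarith))] at h1
  exact sub_eq_zero.1 (norm_le_zero_iff.1 h1)

end Path

/-! ### From sampled residuals to full residuals. -/

section Random

/-- If the nonnegative numbers `a k ω i` depend only on the first `k` of a sequence of independent
uniformly distributed indices, and the sums along the sampled indices are uniformly bounded, then
almost surely the sums over all indices are finite. -/
theorem ae_summable_sum_of_uniform_index {N : ℕ} [NeZero N] {Ω : Type*} [MeasurableSpace Ω]
    {P : Measure Ω} {t : ℕ → Ω → Fin N} (ht : ∀ k, Measurable (t k)) (hindep : iIndepFun t P)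
    (hunif : ∀ k i, P {ω | t k ω = i} = (N : ENNReal)⁻¹)
    {a : ℕ → Ω → Fin N → ℝ} (ha : ∀ k ω i, 0 ≤ a k ω i)
    (hdep : ∀ k ω ω', (∀ m < k, t m ω = t m ω') → a k ω = a k ω') {M : ℝ}
    (hM : ∀ ω n, ∑ k ∈ Finset.range n, a k ω (t k ω) ≤ M) :
    ∀ᵐ ω ∂P, Summable fun k => ∑ i, a k ω i := by
  have hprob : IsProbabilityMeasure P := hindep.isProbabilityMeasure
  have hN0 : (N : ENNReal) ≠ 0 := Nat.cast_ne_zero.2 (NeZero.ne N)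
  have hNtop : (N : ENNReal) ≠ ⊤ := ENNReal.natCast_ne_top N
  -- Factoring through the finite set of index words of length `k` yields both measurability of `a
  -- k` and its independence of `t k`.
  have hfac : ∀ k, ∃ g : (↥(Finset.range k) → Fin N) → Fin N → ℝ,
      ∀ ω, a k ω = g fun m => t m ω := by
    intro k
    have hf : Function.FactorsThrough (a k)
        (fun ω => (fun m => t m ω : ↥(Finset.range k) → Fin N)) := fun ω ω' h =>
      hdep k ω ω' fun m hm => congrFun h ⟨m, Finset.mem_range.2 hm⟩
    exact ⟨Function.extend (fun ω => (fun m => t m ω : ↥(Finset.range k) → Fin N))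
      (a k) 0, fun ω => (hf.extend_apply 0 ω).symm⟩
  choose g hg using hfac
  have hmeas : ∀ k i, Measurable fun ω => ENNReal.ofReal (a k ω i) := by
    intro k i
    have h1 : Measurable fun v => ENNReal.ofReal (g k v i) := Measurable.of_discrete
    have h2 : Measurable fun ω => (fun m => t m ω : ↥(Finset.range k) → Fin N) :=
      measurable_pi_lambda _ fun m => ht m
    simpa only [hg, Function.comp_def] using h1.comp h2
  have hind : ∀ k i, Measurable fun ω => (if t k ω = i then 1 else 0 : ENNReal) := fun k i =>
    (Measurable.of_discrete (f := fun l : Fin N => (if l = i then 1 else 0 : ENNReal))).comp (ht k)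
  have hmul : ∀ k i, Measurable fun ω =>
      ENNReal.ofReal (a k ω i) * (if t k ω = i then 1 else 0 : ENNReal) := fun k i =>
    (hmeas k i).mul (hind k i)
  have hprod : ∀ k i, ∫⁻ ω, ENNReal.ofReal (a k ω i) ∂P =
      N * ∫⁻ ω, ENNReal.ofReal (a k ω i) * (if t k ω = i then 1 else 0) ∂P := by
    intro k i
    have h1 := hindep.indepFun_finset (Finset.range k) {k} (by simp) ht
    have h2 := h1.comp
      (Measurable.of_discrete (f := fun v => ENNReal.ofReal (g k v i)))
      (Measurable.of_discrete (f := fun v : ↥({k} : Finset ℕ) → Fin N =>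
        (if v ⟨k, Finset.mem_singleton_self k⟩ = i then 1 else 0 : ENNReal)))
    have h3 : IndepFun (fun ω => ENNReal.ofReal (a k ω i))
        (fun ω => (if t k ω = i then 1 else 0 : ENNReal)) P := by
      simpa only [hg, Function.comp_def] using h2
    have h4 : ∫⁻ ω, (if t k ω = i then 1 else 0 : ENNReal) ∂P = (N : ENNReal)⁻¹ := by
      have h5 := lintegral_indicator_one (μ := P) (ht k (measurableSet_singleton i))
      refine Eq.trans ?_ (h5.trans (hunif k i))
      refine lintegral_congr fun ω => ?_
      by_cases h : t k ω = i
      · rw [if_pos h, Set.indicator_of_mem (show ω ∈ t k ⁻¹' {i} from h), Pi.one_apply]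
      · rw [if_neg h, Set.indicator_of_notMem (show ω ∉ t k ⁻¹' {i} from h)]
    rw [lintegral_mul_eq_lintegral_mul_lintegral_of_indepFun'' (hmeas k i).aemeasurable
      (hind k i).aemeasurable h3, h4, mul_comm, mul_assoc, ENNReal.inv_mul_cancel hN0 hNtop,
      mul_one]
  have hsample : ∀ k ω, ∑ i, ENNReal.ofReal (a k ω i) * (if t k ω = i then 1 else 0) =
      ENNReal.ofReal (a k ω (t k ω)) := by
    intro k ω
    simp
  have hfin : ∫⁻ ω, ∑' k, ∑ i, ENNReal.ofReal (a k ω i) ∂P ≠ ⊤ := by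
    have h1 : ∫⁻ ω, ∑' k, ∑ i, ENNReal.ofReal (a k ω i) ∂P =
        N * ∫⁻ ω, ∑' k, ENNReal.ofReal (a k ω (t k ω)) ∂P := by
      simp only [← hsample]
      rw [lintegral_tsum fun k => (Finset.measurable_fun_sum _ fun i _ => hmeas k i).aemeasurable,
        lintegral_tsum fun k => (Finset.measurable_fun_sum _ fun i _ => hmul k i).aemeasurable,
        ← ENNReal.tsum_mul_left]
      refine tsum_congr fun k => ?_
      rw [lintegral_finsetSum _ fun i _ => hmeas k i,
        lintegral_finsetSum _ fun i _ => hmul k i, Finset.mul_sum]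
      exact Finset.sum_congr rfl fun i _ => hprod k i
    have h2 : ∫⁻ ω, ∑' k, ENNReal.ofReal (a k ω (t k ω)) ∂P ≤ ENNReal.ofReal M := by
      refine (lintegral_mono (g := fun _ => ENNReal.ofReal M) fun ω => ?_).trans_eq (by simp)
      refine ENNReal.tsum_le_of_sum_range_le fun n => ?_
      rw [← ENNReal.ofReal_sum_of_nonneg fun k _ => ha _ _ _]
      exact ENNReal.ofReal_le_ofReal (hM ω n)
    rw [h1]
    exact ENNReal.mul_ne_top hNtop (ne_top_of_le_ne_top ENNReal.ofReal_ne_top h2)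
  filter_upwards [ae_lt_top (Measurable.tsum fun k =>
    Finset.measurable_fun_sum _ fun i _ => hmeas k i) hfin] with ω hω
  have h1 := ENNReal.summable_toReal hω.ne
  refine h1.congr fun k => ?_
  rw [← ENNReal.ofReal_sum_of_nonneg fun i _ => ha _ _ _,
    ENNReal.toReal_ofReal (Finset.sum_nonneg fun i _ => ha _ _ _)]

end Random

/-! ### Minimisers of the Bregman distance. -/

section MinimumDistance

variable {X : Type*} [NormedAddCommGroup X] [NormedSpace ℝ X] {p : ℝ}

/-- The Bregman distance has exactly one minimiser on a nonempty closed convex set. -/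
theorem IsPConvexSpace.existsUnique_isLeast_bregman [CompleteSpace X] (h : IsPConvexSpace X p)
    (hp : 2 ≤ p) (x₀ : X) {K : Set X} (hne : K.Nonempty) (hcl : IsClosed K)
    (hconv : Convex ℝ K) :
    ∃! z, z ∈ K ∧ IsLeast (bregman p x₀ '' K) (bregman p x₀ z) := by
  have hp1 : 1 < p := by linarith
  have hp0 : 0 < p := by linarith
  obtain ⟨c, hc0, hc⟩ := h.exists_midpoint_norm_rpow_le hp
  set f := bregman p x₀ with hf
  have hmid : ∀ z w : X, f ((1 / 2 : ℝ) • z + (1 / 2 : ℝ) • w) + c / p * ‖z - w‖ ^ p ≤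
      (f z + f w) / 2 := by
    intro z w
    have h1 : ((‖z + w‖ / 2) ^ p + c * ‖z - w‖ ^ p) / p ≤ ((‖z‖ ^ p + ‖w‖ ^ p) / 2) / p :=
      div_le_div_of_nonneg_right (hc z w) hp0.le
    have h2 : ‖(1 / 2 : ℝ) • z + (1 / 2 : ℝ) • w‖ = ‖z + w‖ / 2 := by
      rw [← smul_add, norm_smul, Real.norm_of_nonneg (by norm_num : (0 : ℝ) ≤ 1 / 2),
        one_div_mul_eq_div]
    simp only [hf, bregman, h2, map_add, map_smul, smul_eq_mul]
    rw [div_eq_mul_inv, div_eq_mul_inv _ p] at h1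
    rw [div_eq_mul_inv c p, one_div p]
    linarith
  have hmem : ∀ z ∈ K, ∀ w ∈ K, (1 / 2 : ℝ) • z + (1 / 2 : ℝ) • w ∈ K := fun z hz w hw =>
    hconv hz hw (by norm_num) (by norm_num) (by norm_num)
  set m := sInf (f '' K) with hm
  have hbdd : BddBelow (f '' K) := ⟨0, by rintro _ ⟨z, -, rfl⟩; exact bregman_nonneg hp1 _ _⟩
  have hmle : ∀ z ∈ K, m ≤ f z := fun z hz => csInf_le hbdd ⟨z, hz, rfl⟩
  have hfc : Continuous f := by
    simp only [hf]
    unfold bregman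
    have : Continuous fun w : X => ‖w‖ ^ p := continuous_norm.rpow_const fun _ => Or.inr hp0.le
    fun_prop
  have hcp : 0 < c / p := by positivity
  -- The midpoint lies in `K`, so near-minimisers are close: this yields both a Cauchy minimising
  -- sequence and uniqueness.
  have hdist : ∀ z ∈ K, ∀ w ∈ K, c / p * ‖z - w‖ ^ p ≤ (f z + f w) / 2 - m := fun z hz w hw => by
    linarith [hmid z w, hmle _ (hmem z hz w hw)]
  have hseq : ∀ n : ℕ, ∃ z ∈ K, f z < m + 1 / (n + 1) := fun n => by
    obtain ⟨_, ⟨z, hz, rfl⟩, h1⟩ := exists_lt_of_csInf_lt (hne.image f)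
      (show sInf (f '' K) < m + 1 / ((n : ℝ) + 1) by
        rw [← hm]; exact lt_add_of_pos_right _ (by positivity))
    exact ⟨z, hz, h1⟩
  choose v hvK hv using hseq
  have hcauchy : CauchySeq v := by
    rw [Metric.cauchySeq_iff']
    intro ε hε
    obtain ⟨n, hn⟩ := exists_nat_one_div_lt (show 0 < c / p * ε ^ p by positivity)
    refine ⟨n, fun k hk => ?_⟩
    by_contra! hcon
    rw [dist_eq_norm] at hcon
    have h1 := hdist _ (hvK k) _ (hvK n)
    have h2 : c / p * ε ^ p ≤ c / p * ‖v k - v n‖ ^ p :=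
      mul_le_mul_of_nonneg_left (Real.rpow_le_rpow hε.le hcon hp0.le) hcp.le
    have h3 : 1 / ((k : ℝ) + 1) ≤ 1 / ((n : ℝ) + 1) := by
      have : (n : ℝ) ≤ k := Nat.cast_le.2 hk
      gcongr
    linarith [hv k, hv n]
  obtain ⟨z, hz⟩ := cauchySeq_tendsto_of_complete hcauchy
  have hzK : z ∈ K := hcl.mem_of_tendsto hz (Eventually.of_forall hvK)
  have hfz : f z ≤ m := by
    have h1 : Tendsto (fun n : ℕ => m + 1 / ((n : ℝ) + 1)) atTop (𝓝 (m + 0)) :=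
      tendsto_one_div_add_atTop_nhds_zero_nat.const_add m
    rw [add_zero] at h1
    exact le_of_tendsto_of_tendsto ((hfc.tendsto z).comp hz) h1
      (Eventually.of_forall fun n => (hv n).le)
  refine ⟨z, ⟨hzK, ⟨z, hzK, rfl⟩, ?_⟩, ?_⟩
  · rintro _ ⟨w, hw, rfl⟩
    exact hfz.trans (hmle w hw)
  · rintro w ⟨hwK, -, hw⟩
    have h1 := hdist w hwK z hzK
    have h2 : f w ≤ f z := hw ⟨z, hzK, rfl⟩
    have h3 : c / p * ‖w - z‖ ^ p ≤ 0 := by linarith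
    by_contra hne'
    have h4 : 0 < ‖w - z‖ := norm_pos_iff.2 (sub_ne_zero.2 hne')
    have h5 : 0 < c / p * ‖w - z‖ ^ p := by positivity
    linarith

end MinimumDistance

/-! ### The stochastic iteration and the theorem. -/

section Main

variable {N : ℕ} {X : Type*} [NormedAddCommGroup X] [NormedSpace ℝ X]
  {Y : Fin N → Type*} [∀ i, NormedAddCommGroup (Y i)] [∀ i, NormedSpace ℝ (Y i)]
  {p : ℝ} {F : ∀ i, X → Y i} {F' : ∀ i, X → X →L[ℝ] Y i} {y : ∀ i, Y i} {S : Set X} {γ : ℝ}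
  {j : ∀ i, Y i → StrongDual ℝ (Y i)} {μ : ℕ → ℝ} {s : ℕ → Fin N} {x₀ : X} {u : ℕ → X}

theorem IsSGD.dmap_succ (hsmooth : IsUniformlySmoothSpace X) (hp : 1 < p)
    (hu : IsSGD p F F' y j μ s x₀ u) (k : ℕ) :
    dmap p (u (k + 1)) =
      dmap p (u k) - μ (k + 1) • sgdDirection F F' y j (u k) (s (k + 1)) :=
  hsmooth.dmap_eq_of_inclusion_eq hp (hu.2 k)

/-- The iterates depend only on the indices used so far. -/
theorem IsSGD.eq_of_forall_lt {s' : ℕ → Fin N} {u' : ℕ → X} (hu : IsSGD p F F' y j μ s x₀ u)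
    (hu' : IsSGD p F F' y j μ s' x₀ u') {k : ℕ} (hs : ∀ m < k, s (m + 1) = s' (m + 1)) :
    u k = u' k := by
  induction k with
  | zero => rw [hu.1, hu'.1]
  | succ k ih =>
    have h1 := hu.2 k
    rw [ih fun m hm => hs m (hm.trans k.lt_succ_self), hs k k.lt_succ_self, ← hu'.2 k] at h1
    exact (NormedSpace.inclusionInDoubleDualLi ℝ).injective h1

/-- Descent of the Bregman distance to a solution along the iteration. -/
theorem IsSGD.bregman_succ_le (hsmooth : IsUniformlySmoothSpace X) (hconv : IsPConvexSpace X p)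
    (hp : 2 ≤ p) {L : Fin N → ℝ} (hL : ∀ i, ∀ x ∈ S, ‖F' i x‖ ≤ L i)
    (hTCC : ∀ i, ∀ x ∈ S, ∀ x' ∈ S, ‖F i x - F i x' - F' i x (x - x')‖ ≤ γ * ‖F i x - F i x'‖)
    (hj : ∀ i v, j i v ∈ dualityMap p v) (hμ : ∀ k, 0 < μ (k + 1)) {C : ℝ}
    (hstep : ∀ k, C ≤ 1 - γ - (⨆ i, L i) ^ p.conjExponent *
      (dualBregmanConst X p / p.conjExponent) * μ (k + 1) ^ (p.conjExponent - 1))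
    (hu : IsSGD p F F' y j μ s x₀ u) {z : X} (hz : z ∈ S) (hFz : ∀ i, F i z = y i) {k : ℕ}
    (hk : u k ∈ S) :
    bregman p (u (k + 1)) z +
      C * (μ (k + 1) * ‖F (s (k + 1)) (u k) - y (s (k + 1))‖ ^ p) ≤ bregman p (u k) z := by
  refine bregman_gradient_step_le hp hconv (hj (s (k + 1)) _)
    ((hL _ _ hk).trans (le_ciSup (Set.finite_range L).bddAbove (s (k + 1)))) ?_ (hμ k) (hstep k)
    (hu.dmap_succ hsmooth (by linarith) k)
  have := hTCC (s (k + 1)) _ hk _ hz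
  rwa [hFz] at this

end Main

theorem mainTheorem1
    {N : ℕ} [NeZero N]
    {X : Type*} [NormedAddCommGroup X] [NormedSpace ℝ X] [CompleteSpace X]
    {Y : Fin N → Type*} [∀ i, NormedAddCommGroup (Y i)] [∀ i, NormedSpace ℝ (Y i)]
    [∀ i, CompleteSpace (Y i)]
    {Ω : Type*} [MeasurableSpace Ω] (P : Measure Ω) [IsProbabilityMeasure P]
    -- the space `X`
    (p : ℝ) (hp : 2 ≤ p) (hconv : IsPConvexSpace X p) (hsmooth : IsUniformlySmoothSpace X)
    -- the operators, the exact data, the set `S` and the reference solution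
    (D : Fin N → Set X) (F : ∀ i, X → Y i) (F' : ∀ i, X → X →L[ℝ] Y i) (y : ∀ i, Y i)
    (S : Set X) (hSD : ∀ i, S ⊆ D i)
    (xs : X) (hxs : xs ∈ solutionSet D F y)
    (ν : ℝ) (hν : 0 < ν) (hball : bregmanBall p ν xs ⊆ S)
    -- bounded derivatives
    (hF' : ∀ i, ∀ x ∈ S, HasFDerivWithinAt (F i) (F' i x) S x)
    (L : Fin N → ℝ) (hL : ∀ i, ∀ x ∈ S, ‖F' i x‖ ≤ L i)
    -- tangential cone condition
    (γ : ℝ) (hγ₀ : 0 < γ) (hγ₁ : γ < 1)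
    (hTCC : ∀ i, ∀ x ∈ S, ∀ x' ∈ S, ‖F i x - F i x' - F' i x (x - x')‖ ≤ γ * ‖F i x - F i x'‖)
    -- selections of the duality maps of the spaces `Y i`
    (j : ∀ i, Y i → StrongDual ℝ (Y i)) (hj : ∀ i v, j i v ∈ dualityMap p v)
    -- step sizes
    (μ : ℕ → ℝ) (hμ : ∀ k, 0 < μ (k + 1))
    (C : ℝ) (hC : 0 < C)
    (hstep : ∀ k, C ≤ 1 - γ - (⨆ i, L i) ^ p.conjExponent *
      (dualBregmanConst X p / p.conjExponent) * μ (k + 1) ^ (p.conjExponent - 1))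
    (hsum : Tendsto (fun n => ∑ k ∈ Finset.range n, μ (k + 1)) atTop atTop)
    -- independent, uniformly distributed random indices
    (idx : ℕ → Ω → Fin N) (hidx_meas : ∀ k, Measurable (idx (k + 1)))
    (hidx_indep : iIndepFun (fun k => idx (k + 1)) P)
    (hidx_unif : ∀ k a, P {ω | idx (k + 1) ω = a} = (N : ENNReal)⁻¹)
    -- the iterates
    (x₀ : X) (hx₀ : x₀ ∈ bregmanBall p ν xs)
    (x : ℕ → Ω → X)
    (hx : ∀ ω, IsSGD p F F' y j μ (fun k => idx k ω) x₀ (fun k => x k ω)) :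
    (∀ᵐ ω ∂P,
      (∃ xhat ∈ solutionSet D F y, Tendsto (fun k => x k ω) atTop (𝓝 xhat)) ∧
      Tendsto (fun k => Metric.infDist (x k ω) (solutionSet D F y)) atTop (𝓝 0)) ∧
    (IsClosed S → Convex ℝ S → (∀ i, WeakToWeakContinuousOn (F i) S) →
      (∃! xdag, IsMinDistanceSolution p S F y x₀ xdag) ∧
      ∀ xdag, IsMinDistanceSolution p S F y x₀ xdag →
        (∀ z ∈ S, (⨅ i, (F' i xdag).ker) ≤ ⨅ i, (F' i z).ker) →
        ∀ᵐ ω ∂P, Tendsto (fun k => x k ω) atTop (𝓝 xdag) ∧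
          Tendsto (fun k => bregman p (x k ω) xdag) atTop (𝓝 0)) := by
  have hp1 : 1 < p := by linarith
  have hxsS : xs ∈ S := hball (by simpa [bregmanBall, bregman_self hp1] using hν.le)
  have hFxs : ∀ i, F i xs = y i := fun i => (hxs i).2
  have hterm : ∀ k ω i, 0 ≤ μ (k + 1) * ‖F i (x k ω) - y i‖ ^ p := fun k ω i =>
    mul_nonneg (hμ k).le (by positivity)
  have hdescent : ∀ ω k, x k ω ∈ S → bregman p (x (k + 1) ω) xs +
      C * (μ (k + 1) * ‖F (idx (k + 1) ω) (x k ω) - y (idx (k + 1) ω)‖ ^ p) ≤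
        bregman p (x k ω) xs := fun ω k hk =>
    (hx ω).bregman_succ_le hsmooth hconv hp hL hTCC hj hμ hstep hxsS hFxs hk
  have hxν : ∀ ω k, x k ω ∈ bregmanBall p ν xs := by
    intro ω k
    induction k with
    | zero => rwa [show x 0 ω = x₀ from (hx ω).1]
    | succ k ih =>
      have h1 := hdescent ω k (hball ih)
      have h2 := mul_nonneg hC.le (hterm k ω (idx (k + 1) ω))
      change bregman p (x (k + 1) ω) xs ≤ ν
      have h3 : bregman p (x k ω) xs ≤ ν := ih
      linarith
  have hxS : ∀ ω k, x k ω ∈ S := fun ω k => hball (hxν ω k)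
  have hanti : ∀ ω, Antitone fun k => bregman p (x k ω) xs := fun ω =>
    antitone_nat_of_succ_le fun k => by
      linarith [hdescent ω k (hxS ω k), mul_nonneg hC.le (hterm k ω (idx (k + 1) ω))]
  have hbound : ∀ ω n, ∑ k ∈ Finset.range n,
      μ (k + 1) * ‖F (idx (k + 1) ω) (x k ω) - y (idx (k + 1) ω)‖ ^ p ≤ ν / C := by
    intro ω n
    rw [le_div_iff₀' hC]
    have h1 : C * ∑ k ∈ Finset.range n,
        μ (k + 1) * ‖F (idx (k + 1) ω) (x k ω) - y (idx (k + 1) ω)‖ ^ p ≤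
          bregman p (x 0 ω) xs - bregman p (x n ω) xs := by
      rw [← Finset.sum_range_sub' (fun k => bregman p (x k ω) xs), Finset.mul_sum]
      exact Finset.sum_le_sum fun k _ => by linarith [hdescent ω k (hxS ω k)]
    have h2 : bregman p (x 0 ω) xs ≤ ν := hxν ω 0
    linarith [bregman_nonneg hp1 (x n ω) xs]
  have hae : ∀ᵐ ω ∂P, Summable fun k => μ (k + 1) * residualPow p F y (x k ω) := by
    filter_upwards [ae_summable_sum_of_uniform_index hidx_meas hidx_indep hidx_unif hterm
      (fun k ω ω' h => by rw [(hx ω).eq_of_forall_lt (hx ω') h]) hbound] with ω hω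
    simpa only [residualPow, Finset.mul_sum] using hω
  have hlim : ∀ᵐ ω ∂P, ∃ xhat ∈ S, (∀ i, F i xhat = y i) ∧
      Tendsto (fun k => x k ω) atTop (𝓝 xhat) := by
    filter_upwards [hae] with ω hω
    exact exists_tendsto_of_summable_residualPow hp hconv hsmooth hγ₀ hTCC
      (fun i z hz => (hF' i z hz).continuousWithinAt) hj hμ hsum
      ((hx ω).dmap_succ hsmooth hp1) hν.le hball (hxν ω) hFxs (hanti ω) hω
  refine ⟨?_, fun hScl hSconv _ => ⟨?_, ?_⟩⟩
  · filter_upwards [hlim] with ω ⟨xhat, hxhatS, hFxhat, hxhat⟩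
    have hmem : xhat ∈ solutionSet D F y := fun i => ⟨hSD i hxhatS, hFxhat i⟩
    refine ⟨⟨xhat, hmem, hxhat⟩, ?_⟩
    exact squeeze_zero (fun k => Metric.infDist_nonneg)
      (fun k => Metric.infDist_le_dist_of_mem hmem)
      (tendsto_iff_dist_tendsto_zero.1 hxhat)
  -- Closedness and convexity of the solutions in `S` come from this description by kernels.
  · have hset : {z | z ∈ S ∧ ∀ i, F i z = y i} =
        S ∩ (fun z => z - xs) ⁻¹' (⨅ i, (F' i xs).ker : Submodule ℝ X) := by
      ext z
      exact and_congr_right fun hz => forall_eq_iff_sub_mem_iInf_ker hγ₁ hTCC hxsS hFxs hz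
    have hker : IsClosed ((⨅ i, (F' i xs).ker : Submodule ℝ X) : Set X) := by
      rw [Submodule.coe_iInf]
      exact isClosed_iInter fun i => (F' i xs).isClosed_ker
    have hconvex : Convex ℝ ((fun z => z - xs) ⁻¹' (⨅ i, (F' i xs).ker : Submodule ℝ X)) := by
      simpa only [sub_eq_add_neg] using
        (⨅ i, (F' i xs).ker : Submodule ℝ X).convex.translate_preimage_left (-xs)
    obtain ⟨z, ⟨hz, hzl⟩, huniq⟩ := hconv.existsUnique_isLeast_bregman hp x₀
      (K := {z | z ∈ S ∧ ∀ i, F i z = y i}) ⟨xs, hxsS, hFxs⟩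
      (by rw [hset]; exact hScl.inter (hker.preimage (by fun_prop)))
      (by rw [hset]; exact hSconv.inter hconvex)
    exact ⟨z, ⟨hz.1, hz.2, hzl⟩, fun w hw => huniq w ⟨⟨hw.1, hw.2.1⟩, hw.2.2⟩⟩
  · rintro xdag ⟨hdagS, hFdag, -, hdagmin⟩ hnull
    filter_upwards [hlim] with ω ⟨xhat, hxhatS, hFxhat, hxhat⟩
    obtain ⟨c, hc0, hc⟩ := hconv.exists_midpoint_norm_rpow_le hp
    have hdiff : xhat - xdag ∈ ⨅ i, (F' i xdag).ker :=
      (forall_eq_iff_sub_mem_iInf_ker hγ₁ hTCC hdagS hFdag hxhatS).1 hFxhat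
    have hconst : ∀ k, dmap p (x k ω) (xhat - xdag) = dmap p x₀ (xhat - xdag) := by
      intro k
      induction k with
      | zero => rw [show x 0 ω = x₀ from (hx ω).1]
      | succ k ih =>
        have h1 : F' (idx (k + 1) ω) (x k ω) (xhat - xdag) = 0 :=
          (Submodule.mem_iInf _).1 (hnull _ (hxS ω k) hdiff) (idx (k + 1) ω)
        rw [(hx ω).dmap_succ hsmooth hp1 k, sub_apply, ih, smul_apply, sgdDirection,
          ContinuousLinearMap.comp_apply, h1, map_zero, smul_zero, sub_zero]
    -- The difference of the two distances equals its value at `x₀`, whose sign is given by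
    -- minimality of `xdag`.
    have hle : ∀ k, bregman p (x k ω) xdag ≤ bregman p (x k ω) xhat := by
      intro k
      have h1 := bregman_sub_bregman (p := p) (x k ω) xhat xdag
      have h2 := bregman_sub_bregman (p := p) x₀ xhat xdag
      rw [hconst k] at h1
      have h3 : bregman p x₀ xdag ≤ bregman p x₀ xhat := hdagmin ⟨xhat, ⟨hxhatS, hFxhat⟩, rfl⟩
      linarith
    have hB : Tendsto (fun k => bregman p (x k ω) xhat) atTop (𝓝 0) := by
      have := hsmooth.tendsto_bregman_left hp1 hxhat xhat
      rwa [bregman_self hp1] at this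
    have hB' : Tendsto (fun k => bregman p (x k ω) xdag) atTop (𝓝 0) :=
      squeeze_zero (fun k => bregman_nonneg hp1 _ _) hle hB
    have heq : xhat = xdag := by
      by_contra hne
      have h1 : 2 * c / p * ‖xhat - xdag‖ ^ p ≤ 0 :=
        le_of_tendsto_of_tendsto
          (((hxhat.sub_const xdag).norm.rpow_const (Or.inr (by linarith))).const_mul _) hB'
          (Eventually.of_forall fun k => le_bregman_of_midpoint hp1 hc (x k ω) xdag)
      have h2 : 0 < ‖xhat - xdag‖ := norm_pos_iff.2 (sub_ne_zero.2 hne)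
      have h3 : 0 < 2 * c / p * ‖xhat - xdag‖ ^ p := by positivity
      linarith
    exact ⟨heq ▸ hxhat, hB'⟩
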